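/- Let $I=(-1,1)$, let $0<t\le 1$, and let $v\in L^2(I)$ (real-valued). Let $L_k$ be the Legendre polynomial of degree $k$ normalized by $L_k(1)=1$, let $\phi_k=\sqrt{k+\tfrac12}\,L_k$ be the orthonormal Legendre basis of $L^2(I)$, and let $\hat v_k=\int_{-1}^{1} v\,\phi_k\,dx$, so that $v=\sum_{k\ge 0}\hat v_k\phi_k$ in $L^2(I)$. Let $\mathbb P_n$ be the space of polynomials of degree at most $n$ and $d_2(v,\mathbb P_n)=\inf_{p\in\mathbb P_n}\|v-p\|_{L^2(I)}$. Let $D=d/dx$, $\mathcal L u=-D\big((1-x^2)Du\big)$, and set $R_{2p}u=\mathcal L^p u$ and $R_{2p+1}u=(1-x^2)D\mathcal L^p u$ for $p\ge 0$. Let $\mathscr A^t(\bar I)$ be the space of functions $u$ that are $C^\infty$ in a neighborhood of $\bar I=[-1,1]$ and for which there is a constant $L\ge 0$ with $$\|R_k u\|_{L^2(I)}\le L^{k+1}(k!)^{1/t}\qquad\text{for all } k\ge 0 .$$ Then the following conditions are equivalent: (i) $v\in\mathscr A^t(\bar I)$, that is, $v$ coincides almost everywhere on $I$ with a function in $\mathscr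 A^t(\bar I)$; (ii) there exist $L_1\ge 0$ and $\eta_1>0$ such that $d_2(v,\mathbb P_n)\le L_1e^{-\eta_1 n^t}$ for all $n\ge 0$; (iii) there exist $L_2\ge 0$ and $\eta_2>0$ such that $|\hat v_k|\le L_2e^{-\eta_2 k^t}$ for all $k\ge 0$. -/

import Mathlib

open MeasureTheory Polynomial
open scoped ENNReal Nat ContDiff

noncomputable section

namespace LegendreGevrey

/-- Lebesgue measure on the interval `I = (-1, 1)`. -/
def volI : Measure ℝ := volume.restrict (Set.Ioo (-1) 1)

/-- The (real) space `L²(I)`. -/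
abbrev L2I : Type := Lp ℝ 2 volI

/-- The `L²(I)` norm of a function, with value `∞` when it is not square integrable. -/
def normL2 (w : ℝ → ℝ) : ℝ≥0∞ := eLpNorm w 2 volI

/-- The Legendre polynomial `L_k` (degree `k`, `L_k(1) = 1`, orthogonal on `(-1, 1)`), given by
Rodrigues' formula `L_k = (2 ^ k k!)⁻¹ D ^ k (x ^ 2 - 1) ^ k`. -/
def legendre (k : ℕ) : ℝ[X] :=
  C ((2 ^ k * (k ! : ℝ))⁻¹) * derivative^[k] ((X ^ 2 - 1) ^ k)

/-- The elements `φ_k = (k + 1/2)^(1/2) L_k` of the orthonormal Legendre basis of `L²(I)`. -/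
def phi (k : ℕ) (x : ℝ) : ℝ := √((k : ℝ) + 1 / 2) * (legendre k).eval x

/-- The `k`-th Legendre coefficient of `v`, that is, its inner product with `φ_k` in `L²(I)`. -/
def legendreCoeff (v : L2I) (k : ℕ) : ℝ := ∫ x, v x * phi k x ∂volI

/-- The distance in `L²(I)` of `v` to the space of polynomials of degree at most `n`. -/
def d2 (v : L2I) (n : ℕ) : ℝ≥0∞ :=
  ⨅ p : degreeLE ℝ (n : WithBot ℕ), normL2 fun x => v x - (p : ℝ[X]).eval x

/-- The Legendre operator `u ↦ -D ((1 - x ^ 2) D u)`. -/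
def legendreOp (u : ℝ → ℝ) : ℝ → ℝ := fun x => -deriv (fun y => (1 - y ^ 2) * deriv u y) x

/-- `R k u` is the `p`-th iterate of the Legendre operator on `u` if `k = 2 p`, and
`(1 - x ^ 2) D` of that iterate if `k = 2 p + 1`. -/
def R (k : ℕ) (u : ℝ → ℝ) : ℝ → ℝ :=
  if Even k then legendreOp^[k / 2] u
  else fun x => (1 - x ^ 2) * deriv (legendreOp^[k / 2] u) x

/-- `u` is a member of the Baouendi–Goulaouic Gevrey space of order `t` on `[-1, 1]`. -/
def IsBGGevrey (t : ℝ) (u : ℝ → ℝ) : Prop :=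
  (∃ U : Set ℝ, IsOpen U ∧ Set.Icc (-1) 1 ⊆ U ∧ ContDiffOn ℝ ∞ u U) ∧
  ∃ L : ℝ, 0 ≤ L ∧ ∀ k : ℕ, normL2 (R k u) ≤ ENNReal.ofReal (L ^ (k + 1) * (k ! : ℝ) ^ (1 / t))

/-- An element of `L²(I)` lies in the Gevrey space if one of its representatives does. -/
def MemBGGevrey (t : ℝ) (v : L2I) : Prop :=
  ∃ u : ℝ → ℝ, IsBGGevrey t u ∧ (v : ℝ → ℝ) =ᵐ[volI] u

end LegendreGevrey

end

noncomputable section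

namespace LegendreGevrey

open scoped RealInnerProductSpace

/-! The Legendre polynomials are eigenfunctions of the Legendre operator with eigenvalues `k (k +
1)`, and that operator is symmetric without boundary conditions because `1 - x ^ 2` vanishes at
`±1`. Both directions between (i) and (iii) rest on this.

(i) to (iii): applying the operator `p` times multiplies the `k`-th coefficient by `(k (k + 1)) ^
p`, so the even-index Gevrey bounds give `k ^ (2p) |c_k| ≤ K ^ (2p+1) ((2p)!) ^ (1/t)`. Taking `2p`
comparable to `k ^ t` yields the decay (`coeff_bound_of_memBGGevrey`).

(iii) to (i): `φ_k` and its derivatives grow polynomially in `k` on `[-1, 1]`, so the series may be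
differentiated termwise, and `R n` is bounded by the moment of order `n + 2` of the coefficients
(`RapidlyDecreasing.abs_R_le`). Exponential decay gives these moments Gevrey growth
(`RapidDecay.exists_tsum_le`). Smoothness in a neighbourhood of `[-1, 1]` needs more: off the
interval `φ_k` grows exponentially in `k`, and for `t < 1` the series may diverge. But `φ_k` stays
under control up to distance `(k + 1) ^ (-2)`, so each term is cut off at that scale. Each
derivative of the cutoff costs only a power of `k`, and the modified series is smooth on the whole
line (`contDiff_legendreSeries`).

(ii) and (iii): `c_k` is at most the distance to polynomials of degree below `k`, by orthogonality;
conversely that distance is at most the tail of the coefficients. -/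

/-! ### Recurrences, differential equation and degree of the Legendre polynomials -/

lemma iterate_derivative_succ_X_mul (f : ℝ[X]) (n : ℕ) :
    derivative^[n + 1] (X * f) = X * derivative^[n + 1] f + C ((n : ℝ) + 1) * derivative^[n] f := by
  induction n with
  | zero => simp; ring
  | succ n ih =>
    rw [Function.iterate_succ_apply', ih, Function.iterate_succ_apply' _ (n + 1) f,
      Function.iterate_succ_apply' _ n f]
    simp only [derivative_mul, derivative_X, derivative_C, derivative_one, map_add, C_1,
      Nat.cast_add, Nat.cast_one]
    ring

lemma legendre_zero : legendre 0 = 1 := by simp [legendre]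

lemma legendre_one : legendre 1 = X := by
  simp only [legendre, pow_one, Nat.factorial_one, Nat.cast_one, mul_one, Function.iterate_one,
    derivative_sub, derivative_X_sq, derivative_one, sub_zero]
  rw [← mul_assoc, ← C_mul]
  simp

/-- Rodrigues' formula: one derivative of `(x ^ 2 - 1) ^ (n + 1)` produces `x (x ^ 2 - 1) ^ n`, and
Leibniz handles the factor `x`. -/
lemma derivative_legendre_succ (n : ℕ) :
    derivative (legendre (n + 1)) = X * derivative (legendre n) + C ((n : ℝ) + 1) * legendre n := by
  have h : derivative ((X ^ 2 - 1 : ℝ[X]) ^ (n + 1))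
      = C (2 * ((n : ℝ) + 1)) * (X * (X ^ 2 - 1) ^ n) := by
    simp [derivative_pow]; ring
  have hc : ((2 : ℝ) ^ (n + 1) * ((n + 1)! : ℝ))⁻¹ * (2 * ((n : ℝ) + 1)) =
      (2 ^ n * (n ! : ℝ))⁻¹ := by
    rw [Nat.factorial_succ]; push_cast; field_simp; ring
  unfold legendre
  rw [derivative_C_mul, ← Function.iterate_succ_apply' derivative, Function.iterate_succ_apply, h,
    iterate_derivative_C_mul, ← mul_assoc, ← C_mul, hc, iterate_derivative_succ_X_mul,
    derivative_C_mul, ← Function.iterate_succ_apply' derivative]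
  ring

/-- Two derivatives of `(x ^ 2 - 1) ^ (n + 2)`, with `x ^ 2` written as `(x ^ 2 - 1) + 1`, leave
only powers of `x ^ 2 - 1`. -/
lemma derivative_legendre_add_two (n : ℕ) :
    derivative (legendre (n + 2)) =
      C (2 * (n : ℝ) + 3) * legendre (n + 1) + derivative (legendre n) := by
  have h : derivative (derivative ((X ^ 2 - 1 : ℝ[X]) ^ (n + 2)))
      = C (2 * ((n : ℝ) + 2)) * (C (2 * (n : ℝ) + 3) * (X ^ 2 - 1) ^ (n + 1)
        + C (2 * ((n : ℝ) + 1)) * (X ^ 2 - 1) ^ n) := by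
    simp only [derivative_pow, derivative_mul, derivative_sub, derivative_X, derivative_one,
      derivative_zero,
      map_add, map_mul, C_1, Nat.cast_add, Nat.cast_ofNat, Nat.cast_one,
      derivative_natCast, Nat.add_sub_cancel, derivative_ofNat, map_natCast,
      show (C 2 : ℝ[X]) = 2 from rfl, show (C 3 : ℝ[X]) = 3 from rfl,
      show n + 2 - 1 = n + 1 from rfl]
    ring
  have hc : ((2 : ℝ) ^ (n + 2) * ((n + 2)! : ℝ))⁻¹ * (2 * ((n : ℝ) + 2))
      = (2 ^ (n + 1) * ((n + 1)! : ℝ))⁻¹ := by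
    rw [Nat.factorial_succ (n + 1)]; push_cast; field_simp; ring
  have hc' : ((2 : ℝ) ^ (n + 1) * ((n + 1)! : ℝ))⁻¹ * (2 * ((n : ℝ) + 1))
      = (2 ^ n * (n ! : ℝ))⁻¹ := by
    rw [Nat.factorial_succ]; push_cast; field_simp; ring
  unfold legendre
  rw [derivative_C_mul, ← Function.iterate_succ_apply' derivative, Function.iterate_succ_apply,
    Function.iterate_succ_apply, h, iterate_derivative_C_mul, ← mul_assoc, ← C_mul, hc,
    iterate_map_add, iterate_derivative_C_mul, iterate_derivative_C_mul, derivative_C_mul,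
    ← Function.iterate_succ_apply' derivative n, ← hc', C_mul (b := 2 * ((n : ℝ) + 1))]
  ring

lemma sq_sub_one_mul_derivative_legendre (n : ℕ) :
    (X ^ 2 - 1) * derivative (legendre (n + 1)) =
      C ((n : ℝ) + 1) * (X * legendre (n + 1) - legendre n) := by
  have h1 := derivative_legendre_succ n
  have h2 := derivative_legendre_succ (n + 1)
  have h3 := derivative_legendre_add_two n
  simp only [map_add, map_mul, C_1, Nat.cast_add, Nat.cast_one,
    show (C 2 : ℝ[X]) = 2 from rfl, show (C 3 : ℝ[X]) = 3 from rfl] at *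
  linear_combination X * h3 - X * h2 - h1

lemma legendre_ode (n : ℕ) :
    derivative ((1 - X ^ 2) * derivative (legendre n)) =
      -(C ((n : ℝ) * (n + 1)) * legendre n) := by
  cases n with
  | zero => simp [legendre_zero]
  | succ n =>
    have h1 := derivative_legendre_succ (n + 1)
    have h2 := derivative_legendre_add_two n
    have h : (1 - X ^ 2) * derivative (legendre (n + 1)) =
      -(C ((n : ℝ) + 1) * (X * legendre (n + 1) - legendre n)) := by
      rw [← sq_sub_one_mul_derivative_legendre]; ring
    rw [h]
    simp only [derivative_neg, derivative_mul, derivative_sub, derivative_C, derivative_X,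
      derivative_one,
      map_add, map_mul, C_1, Nat.cast_add, Nat.cast_one,
      show (C 2 : ℝ[X]) = 2 from rfl, show (C 3 : ℝ[X]) = 3 from rfl] at *
    linear_combination (C (n : ℝ) + 1) * (h1 - h2)

lemma legendre_eval_one (n : ℕ) : (legendre n).eval 1 = 1 := by
  induction n with
  | zero => simp [legendre_zero]
  | succ n ih =>
    have h := congrArg (eval 1) (sq_sub_one_mul_derivative_legendre n)
    have : (n : ℝ) + 1 ≠ 0 := by positivity
    simp [this, ih] at h
    linarith

lemma legendre_eval_neg_one_sq (n : ℕ) : (legendre n).eval (-1) ^ 2 = 1 := by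
  induction n with
  | zero => simp [legendre_zero]
  | succ n ih =>
    have h := congrArg (eval (-1)) (sq_sub_one_mul_derivative_legendre n)
    have : (n : ℝ) + 1 ≠ 0 := by positivity
    simp [this] at h
    rw [show (legendre (n + 1)).eval (-1) = - (legendre n).eval (-1) by linarith, neg_sq, ih]

lemma natDegree_legendre (n : ℕ) : (legendre n).natDegree = n := by
  have hq : (X ^ 2 - 1 : ℝ[X]).natDegree = 2 := by
    rw [← C_1]; exact natDegree_X_pow_sub_C
  have hm : ((X ^ 2 - 1 : ℝ[X]) ^ n).natDegree = 2 * n := by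
    rw [natDegree_pow, hq, mul_comm]
  have hmon : ((X ^ 2 - 1 : ℝ[X]) ^ n).Monic := by
    refine Monic.pow ?_ n
    rw [← C_1]; exact monic_X_pow_sub_C _ two_ne_zero
  unfold legendre
  rw [natDegree_C_mul (by positivity)]
  refine le_antisymm ((natDegree_iterate_derivative _ _).trans (by omega))
    (le_natDegree_of_ne_zero ?_)
  rw [coeff_iterate_derivative, ← two_mul, ← hm, hmon.coeff_natDegree, hm]
  simp [Nat.descFactorial_eq_zero_iff_lt]
  omega

lemma degree_legendre (n : ℕ) : (legendre n).degree = n := by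
  have : legendre n ≠ 0 := fun h => by simpa [h] using legendre_eval_one n
  rw [degree_eq_natDegree this, natDegree_legendre]

/-- The Legendre polynomials as a polynomial sequence. -/
def legendreSequence : Polynomial.Sequence ℝ := ⟨legendre, degree_legendre⟩

lemma span_range_legendre : Submodule.span ℝ (Set.range legendre) = ⊤ :=
  legendreSequence.span fun i => by simp

/-! ### Bounds -/

/-- Energy argument: by the differential equation, `q = n (n + 1) P ^ 2 + (1 - x ^ 2) P' ^ 2` has
derivative `2 x P' ^ 2`, so on `[-1, 1]` it is largest at the endpoints, where it equals `n (n +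
1)`. -/
lemma legendre_eval_sq_le_one (n : ℕ) {x : ℝ} (hx : x ∈ Set.Icc (-1 : ℝ) 1) :
    (legendre n).eval x ^ 2 ≤ 1 := by
  rcases Nat.eq_zero_or_pos n with rfl | hn
  · simp [legendre_zero]
  set q : ℝ[X] := C ((n : ℝ) * (n + 1)) * legendre n ^ 2 + (1 - X ^ 2) * derivative (legendre n) ^ 2
    with hq
  have hc : 0 < (n : ℝ) * (n + 1) := by positivity
  have hd : derivative q = 2 * X * derivative (legendre n) ^ 2 := by
    have h := legendre_ode n
    simp only [hq, derivative_add, derivative_mul, derivative_pow, derivative_sub, derivative_one,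
      derivative_X, derivative_C, Nat.cast_ofNat, show (C 2 : ℝ[X]) = 2 from rfl] at h ⊢
    linear_combination 2 * derivative (legendre n) * h
  have hle : (n : ℝ) * (n + 1) * (legendre n).eval x ^ 2 ≤ q.eval x := by
    have : 0 ≤ 1 - x ^ 2 := by nlinarith [hx.1, hx.2]
    simp only [hq, eval_add, eval_mul, eval_C, eval_pow, eval_sub, eval_one, eval_X]
    have := mul_nonneg this (sq_nonneg ((derivative (legendre n)).eval x))
    linarith
  have hderiv : ∀ y, deriv (fun y => q.eval y) y =
      2 * y * (derivative (legendre n)).eval y ^ 2 := by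
    intro y; rw [Polynomial.deriv, hd]; simp
  have hend : q.eval x ≤ n * (n + 1) := by
    rcases le_total 0 x with h0 | h0
    · have : MonotoneOn (fun y => q.eval y) (Set.Icc 0 1) := by
        refine monotoneOn_of_deriv_nonneg (convex_Icc _ _) q.continuous.continuousOn
          q.differentiable.differentiableOn fun y hy => ?_
        rw [interior_Icc] at hy
        rw [hderiv]; have := hy.1; positivity
      have := this ⟨h0, hx.2⟩ ⟨zero_le_one, le_rfl⟩ hx.2
      simpa [hq, legendre_eval_one] using this
    · have : AntitoneOn (fun y => q.eval y) (Set.Icc (-1) 0) := by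
        refine antitoneOn_of_deriv_nonpos (convex_Icc _ _) q.continuous.continuousOn
          q.differentiable.differentiableOn fun y hy => ?_
        rw [interior_Icc] at hy
        rw [hderiv]
        exact mul_nonpos_of_nonpos_of_nonneg (by linarith [hy.2]) (sq_nonneg _)
      have := this ⟨le_rfl, by norm_num⟩ ⟨hx.1, h0⟩ hx.1
      simpa [hq, legendre_eval_neg_one_sq] using this
  have := hle.trans hend
  by_contra! hlt
  nlinarith

lemma abs_legendre_eval_le_one (n : ℕ) {x : ℝ} (hx : x ∈ Set.Icc (-1 : ℝ) 1) :
    |(legendre n).eval x| ≤ 1 := by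
  have := legendre_eval_sq_le_one n hx
  exact (sq_le_one_iff_abs_le_one _).1 this

/-- Bounds on Legendre polynomials at a point transfer to their derivatives. -/
lemma abs_iterate_derivative_legendre_le {x A : ℝ} {k : ℕ}
    (h : ∀ l ≤ k, |(legendre l).eval x| ≤ A) (j : ℕ) :
    ∀ l ≤ k, |(derivative^[j] (legendre l)).eval x| ≤ A * (l : ℝ) ^ (2 * j) := by
  induction j with
  | zero => simpa using h
  | succ j ih =>
    have hA : 0 ≤ A := (abs_nonneg _).trans (h 0 (Nat.zero_le k))
    -- Induction in steps of two through `L_{l+2}' = (2l + 3) L_{l+1} + L_l'`; it closes because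
    -- `(2l + 3) + l ^ 2 ≤ (l + 2) ^ 2`.
    intro l
    induction l using Nat.strong_induction_on with
    | _ l ihl =>
      intro hl
      match l, ihl, hl with
      | 0, _, _ =>
        simp [legendre_zero]
      | 1, _, _ =>
        rcases j with _ | j
        · simpa [legendre_one, legendre_zero] using h 0 (Nat.zero_le k)
        · simp [legendre_one, hA]
      | l + 2, ihl, hl =>
        have h1 := ih (l + 1) (by omega)
        have h2 := ihl l (by omega) (by omega)
        rw [Function.iterate_succ_apply, derivative_legendre_add_two, iterate_map_add,
          iterate_derivative_C_mul, ← Function.iterate_succ_apply derivative, eval_add, eval_mul,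
          eval_C]
        have e1 : |(2 * (l : ℝ) + 3) * eval x (derivative^[j] (legendre (l + 1)))|
            ≤ (2 * (l : ℝ) + 3) * (A * ((l : ℝ) + 2) ^ (2 * j)) := by
          rw [abs_mul, abs_of_nonneg (by positivity)]
          push_cast at h1
          refine mul_le_mul_of_nonneg_left (h1.trans ?_) (by positivity)
          gcongr; linarith
        have e2 : A * (l : ℝ) ^ (2 * (j + 1)) ≤ (l : ℝ) ^ 2 * (A * ((l : ℝ) + 2) ^ (2 * j)) := by
          rw [show A * (l : ℝ) ^ (2 * (j + 1)) = (l : ℝ) ^ 2 * (A * (l : ℝ) ^ (2 * j)) by ring]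
          gcongr; linarith
        have e3 : 0 ≤ A * ((l : ℝ) + 2) ^ (2 * j) := by positivity
        have e4 : A * ((l + 2 : ℕ) : ℝ) ^ (2 * (j + 1))
            = ((l : ℝ) + 2) ^ 2 * (A * ((l : ℝ) + 2) ^ (2 * j)) := by push_cast; ring
        rw [e4]
        refine (abs_add_le _ _).trans ?_
        nlinarith

/-- Legendre polynomials stay bounded slightly beyond the interval `[-1, 1]`. -/
lemma abs_legendre_eval_le_exp (n : ℕ) {x : ℝ} (hx : ((n : ℝ) ^ 2) * (|x| - 1) ≤ 1) :
    |(legendre n).eval x| ≤ Real.exp 1 := by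
  by_cases hx1 : x ∈ Set.Icc (-1 : ℝ) 1
  · exact (abs_legendre_eval_le_one n hx1).trans (Real.one_le_exp zero_le_one)
  -- Taylor expansion at the nearest endpoint `a`: the `j`-th derivative there is at most `n ^
  -- (2j)`, so the sum is dominated by the series of `exp (n ^ 2 (|x| - 1))`.
  have key : ∀ a ∈ Set.Icc (-1 : ℝ) 1, |x - a| = |x| - 1 →
      |(legendre n).eval x| ≤ Real.exp 1 := by
    intro a ha hxa
    have hT : (legendre n).eval x
        = ∑ j ∈ Finset.range (n + 1), (derivative^[j] (legendre n)).eval a / j ! * (x - a) ^ j := by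
      have h1 : (legendre n).eval x = (taylor a (legendre n)).eval (x - a) := by
        rw [taylor_eval]; congr 1; ring
      rw [h1, eval_eq_sum_range, natDegree_taylor, natDegree_legendre]
      refine Finset.sum_congr rfl fun j _ => ?_
      rw [taylor_coeff]
      have := congrArg (eval a) (congrFun (factorial_smul_hasseDeriv (R := ℝ) j) (legendre n))
      rw [LinearMap.smul_apply, eval_smul, nsmul_eq_mul] at this
      rw [← this]
      field_simp
    have hb : ∀ l ≤ n, |(legendre l).eval a| ≤ 1 := fun l _ => abs_legendre_eval_le_one l ha
    rw [hT]
    calc _ ≤ ∑ j ∈ Finset.range (n + 1), ((n : ℝ) ^ 2 * (|x| - 1)) ^ j / j ! := by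
          refine (Finset.abs_sum_le_sum_abs _ _).trans (Finset.sum_le_sum fun j _ => ?_)
          have := abs_iterate_derivative_legendre_le hb j n le_rfl
          rw [one_mul] at this
          rw [abs_mul, abs_div, abs_pow, hxa, Nat.abs_cast, mul_pow, ← pow_mul, mul_div_right_comm]
          have : 0 ≤ |x| - 1 := hxa ▸ abs_nonneg _
          gcongr
      _ ≤ Real.exp ((n : ℝ) ^ 2 * (|x| - 1)) :=
          Real.sum_le_exp_of_nonneg
            (mul_nonneg (by positivity) (hxa ▸ abs_nonneg _)) _
      _ ≤ Real.exp 1 := Real.exp_le_exp.2 hx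
  rcases le_total 0 x with h | h
  · have : 1 < x := by by_contra! h'; exact hx1 ⟨by linarith, h'⟩
    refine key 1 (by norm_num) ?_
    rw [abs_of_pos (by linarith), abs_of_pos (by linarith)]
  · have : x < -1 := by by_contra! h'; exact hx1 ⟨h', by linarith⟩
    refine key (-1) (by norm_num) ?_
    rw [abs_of_neg (by linarith), abs_of_neg (by linarith)]; ring

/-! ### Symmetry of the Legendre operator and orthogonality -/

instance : IsFiniteMeasure volI := by unfold volI; infer_instance

lemma integral_volI (f : ℝ → ℝ) : ∫ x, f x ∂volI = ∫ x in (-1)..1, f x := by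
  rw [intervalIntegral.integral_of_le (by norm_num), integral_Ioc_eq_integral_Ioo, volI]

lemma ae_volI_mem : ∀ᵐ x ∂volI, x ∈ Set.Ioo (-1 : ℝ) 1 :=
  ae_restrict_mem measurableSet_Ioo

/-- The action of the Legendre operator on polynomials. -/
def polyLegendreOp (q : ℝ[X]) : ℝ[X] := -derivative ((1 - X ^ 2) * derivative q)

lemma polyLegendreOp_legendre (n : ℕ) :
    polyLegendreOp (legendre n) = C ((n : ℝ) * (n + 1)) * legendre n := by
  rw [polyLegendreOp, legendre_ode, neg_neg]

lemma contDiffOn_deriv {u : ℝ → ℝ} {U : Set ℝ} (hU : IsOpen U) (hu : ContDiffOn ℝ ∞ u U) :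
    ContDiffOn ℝ ∞ (deriv u) U :=
  hu.deriv_of_isOpen hU (by simp)

lemma contDiffOn_one_sub_sq_mul_deriv {u : ℝ → ℝ} {U : Set ℝ} (hU : IsOpen U)
    (hu : ContDiffOn ℝ ∞ u U) : ContDiffOn ℝ ∞ (fun y => (1 - y ^ 2) * deriv u y) U :=
  (by fun_prop : ContDiff ℝ ∞ fun y : ℝ => 1 - y ^ 2).contDiffOn.mul (contDiffOn_deriv hU hu)

lemma contDiffOn_legendreOp {u : ℝ → ℝ} {U : Set ℝ} (hU : IsOpen U) (hu : ContDiffOn ℝ ∞ u U) :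
    ContDiffOn ℝ ∞ (legendreOp u) U :=
  (contDiffOn_deriv hU (contDiffOn_one_sub_sq_mul_deriv hU hu)).neg

lemma contDiffOn_iterate_legendreOp {u : ℝ → ℝ} {U : Set ℝ} (hU : IsOpen U)
    (hu : ContDiffOn ℝ ∞ u U) (p : ℕ) : ContDiffOn ℝ ∞ (legendreOp^[p] u) U := by
  induction p with
  | zero => exact hu
  | succ p ih => rw [Function.iterate_succ_apply']; exact contDiffOn_legendreOp hU ih

/-- The Legendre operator is symmetric on functions smooth up to the boundary. -/
lemma integral_legendreOp_mul {u : ℝ → ℝ} {U : Set ℝ} (hU : IsOpen U)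
    (hIU : Set.Icc (-1) 1 ⊆ U) (hu : ContDiffOn ℝ ∞ u U) (q : ℝ[X]) :
    ∫ x in (-1)..1, legendreOp u x * q.eval x =
      ∫ x in (-1)..1, u x * (polyLegendreOp q).eval x := by
  have hI : Set.uIcc (-1 : ℝ) 1 = Set.Icc (-1) 1 := Set.uIcc_of_le (by norm_num)
  have hdiff : ∀ {f : ℝ → ℝ}, ContDiffOn ℝ ∞ f U → ∀ x ∈ Set.uIcc (-1 : ℝ) 1,
      HasDerivAt f (deriv f x) x := fun {f} hf x hx =>
    ((hf.contDiffAt (hU.mem_nhds (hIU (hI ▸ hx)))).differentiableAt (by simp)).hasDerivAt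
  have hint : ∀ {f : ℝ → ℝ}, ContDiffOn ℝ ∞ f U → ∀ r : ℝ[X],
      IntervalIntegrable (fun x => f x * r.eval x) volume (-1) 1 := fun {f} hf r =>
    ContinuousOn.intervalIntegrable
      ((hf.continuousOn.mono (hI ▸ hIU)).mul r.continuous.continuousOn)
  have h1 := hint (contDiffOn_legendreOp hU hu) q
  have h2 := hint hu (polyLegendreOp q)
  rw [← sub_eq_zero, ← intervalIntegral.integral_sub h1 h2]
  -- Lagrange's identity: the difference of the integrands is exact, and its primitive carries the
  -- factor `1 - y ^ 2`, hence vanishes at both ends.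
  have hF : ∀ x ∈ Set.uIcc (-1 : ℝ) 1, HasDerivAt
      (fun y => u y * ((1 - X ^ 2) * derivative q).eval y - (1 - y ^ 2) * deriv u y * q.eval y)
      (legendreOp u x * q.eval x - u x * (polyLegendreOp q).eval x) x := by
    intro x hx
    have hd := ((hdiff hu x hx).mul (((1 - X ^ 2) * derivative q).hasDerivAt x)).sub
      ((hdiff (contDiffOn_one_sub_sq_mul_deriv hU hu) x hx).mul (q.hasDerivAt x))
    refine hd.congr_deriv ?_
    simp only [legendreOp, polyLegendreOp, eval_neg, eval_mul, eval_sub, eval_one, eval_pow, eval_X]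
    ring
  rw [intervalIntegral.integral_eq_sub_of_hasDerivAt hF (h1.sub h2)]
  simp

lemma legendreOp_eval (q : ℝ[X]) (x : ℝ) :
    legendreOp (fun y => q.eval y) x = (polyLegendreOp q).eval x := by
  have : (fun y => (1 - y ^ 2) * deriv (fun y => q.eval y) y)
      = fun y => ((1 - X ^ 2) * derivative q).eval y := by
    ext y; simp [Polynomial.deriv]
  rw [legendreOp, this, Polynomial.deriv, polyLegendreOp, eval_neg]

lemma contDiff_eval (q : ℝ[X]) : ContDiff ℝ ∞ fun x => q.eval x := by
  simpa using q.contDiff_aeval (𝕜 := ℝ) ∞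

lemma integral_legendre_mul_legendre_of_ne {m n : ℕ} (h : m ≠ n) :
    ∫ x in (-1)..1, (legendre m).eval x * (legendre n).eval x = 0 := by
  have := integral_legendreOp_mul isOpen_univ (Set.subset_univ _)
    (contDiff_eval (legendre m)).contDiffOn (legendre n)
  simp only [legendreOp_eval, polyLegendreOp_legendre, eval_mul, eval_C] at this
  simp only [mul_assoc ((m : ℝ) * (m + 1)), mul_left_comm _ ((n : ℝ) * (n + 1)),
    intervalIntegral.integral_const_mul] at this
  have hmn : (m : ℝ) * (m + 1) - n * (n + 1) ≠ 0 := by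
    have : ((m : ℝ) - n) ≠ 0 := sub_ne_zero.2 (by exact_mod_cast h)
    rw [show (m : ℝ) * (m + 1) - n * (n + 1) = (m - n) * (m + n + 1) by ring]
    positivity
  exact (mul_eq_zero.1 (by linear_combination this :
    ((m : ℝ) * (m + 1) - n * (n + 1)) *
      ∫ x in (-1)..1, (legendre m).eval x * (legendre n).eval x = 0)).resolve_left hmn

lemma intervalIntegrable_eval_mul (p q : ℝ[X]) :
    IntervalIntegrable (fun x => p.eval x * q.eval x) volume (-1) 1 :=
  (p.continuous.mul q.continuous).intervalIntegrable _ _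

lemma integral_mul_legendre_of_degree_lt {n : ℕ} {p : ℝ[X]} (hp : p.degree < n) :
    ∫ x in (-1)..1, p.eval x * (legendre n).eval x = 0 := by
  have hp' : p ∈ Submodule.span ℝ (legendre '' Set.Iio n) := by
    have h := legendreSequence.span_degreeLT (m := n) fun i _ => by simp
    exact h ▸ mem_degreeLT.2 hp
  clear hp
  induction hp' using Submodule.span_induction with
  | mem x hx =>
    obtain ⟨i, hi, rfl⟩ := hx
    exact integral_legendre_mul_legendre_of_ne (ne_of_lt hi)
  | zero => simp
  | add x y _ _ hx hy =>
    simp only [eval_add, add_mul]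
    rw [intervalIntegral.integral_add (intervalIntegrable_eval_mul _ _)
      (intervalIntegrable_eval_mul _ _), hx, hy, add_zero]
  | smul a x _ hx =>
    simp only [eval_smul, smul_eq_mul, mul_assoc]
    rw [intervalIntegral.integral_const_mul, hx, mul_zero]

/-- Integrate `(x P ^ 2)'` for `P = L_{n+1}`. Since `x P' = (n + 1) P + L_n'`, it equals `(2n + 3) P
^ 2 + 2 L_n' P`; the last term integrates to zero by degree, and the boundary terms total `2`. -/
lemma integral_legendre_sq (n : ℕ) :
    ((n : ℝ) + 1 / 2) * ∫ x in (-1)..1, (legendre n).eval x * (legendre n).eval x = 1 := by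
  rcases n with _ | n
  · simp [legendre_zero]; norm_num
  have hP : derivative (X * legendre (n + 1) ^ 2) = C (2 * (n : ℝ) + 3) * (legendre (n + 1) *
      legendre (n + 1)) + C 2 * (derivative (legendre n) * legendre (n + 1)) := by
    have h1 := derivative_legendre_succ (n + 1)
    have h2 := derivative_legendre_add_two n
    simp only [derivative_mul, derivative_pow, derivative_X, map_add, map_mul, C_1, Nat.cast_add,
      Nat.cast_one, Nat.cast_ofNat, show (C 2 : ℝ[X]) = 2 from rfl,
      show (C 3 : ℝ[X]) = 3 from rfl] at *
    linear_combination 2 * legendre (n + 1) * (h2 - h1)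
  have hF := intervalIntegral.integral_eq_sub_of_hasDerivAt
    (fun x (_ : x ∈ Set.uIcc (-1 : ℝ) 1) => (X * legendre (n + 1) ^ 2).hasDerivAt x)
    ((derivative (X * legendre (n + 1) ^ 2)).continuous.intervalIntegrable _ _)
  have h0 : ∫ x in (-1)..1, (derivative (legendre n)).eval x * (legendre (n + 1)).eval x = 0 := by
    refine integral_mul_legendre_of_degree_lt ?_
    refine (degree_derivative_le).trans_lt ?_
    rw [degree_legendre]
    exact_mod_cast n.lt_succ_self
  simp only [hP, eval_add, eval_mul, eval_C, eval_X, eval_pow, legendre_eval_one,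
    legendre_eval_neg_one_sq] at hF
  rw [intervalIntegral.integral_add ((intervalIntegrable_eval_mul _ _).const_mul _)
    ((intervalIntegrable_eval_mul _ _).const_mul _), intervalIntegral.integral_const_mul,
    intervalIntegral.integral_const_mul, h0] at hF
  push_cast
  linear_combination hF / 2

/-! ### The orthonormal Legendre basis of `L²(I)` -/

lemma memLp_eval (q : ℝ[X]) : MemLp (fun x => q.eval x) 2 volI := by
  obtain ⟨M, hM⟩ := isCompact_Icc.exists_bound_of_continuousOn
    (q.continuous.continuousOn (s := Set.Icc (-1 : ℝ) 1))
  exact MemLp.of_bound q.continuous.aestronglyMeasurable M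
    (ae_volI_mem.mono fun x hx => hM x (Set.Ioo_subset_Icc_self hx))

/-- Polynomials as elements of `L²(I)`. -/
def polyL2 : ℝ[X] →ₗ[ℝ] L2I where
  toFun q := (memLp_eval q).toLp
  map_add' p q := by
    rw [← MemLp.toLp_add]
    exact MemLp.toLp_congr _ _ (by simp [Filter.EventuallyEq])
  map_smul' a q := by
    rw [RingHom.id_apply, ← MemLp.toLp_const_smul]
    exact MemLp.toLp_congr _ _ (by simp [Filter.EventuallyEq])

lemma coeFn_polyL2 (q : ℝ[X]) : polyL2 q =ᵐ[volI] fun x => q.eval x := (memLp_eval q).coeFn_toLp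

lemma inner_polyL2 (q : ℝ[X]) (v : L2I) : ⟪polyL2 q, v⟫ = ∫ x, v x * q.eval x ∂volI := by
  rw [L2.inner_def]
  refine integral_congr_ae ?_
  filter_upwards [coeFn_polyL2 q] with x hx
  simp [hx]

lemma inner_polyL2_polyL2 (p q : ℝ[X]) :
    ⟪polyL2 p, polyL2 q⟫ = ∫ x in (-1)..1, q.eval x * p.eval x := by
  rw [inner_polyL2, ← integral_volI]
  refine integral_congr_ae ?_
  filter_upwards [coeFn_polyL2 q] with x hx
  rw [hx]

/-- The polynomial `φ_k`. -/
def phiPoly (k : ℕ) : ℝ[X] := C √((k : ℝ) + 1 / 2) * legendre k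

lemma eval_phiPoly (k : ℕ) (x : ℝ) : (phiPoly k).eval x = phi k x := by simp [phiPoly, phi]

lemma polyL2_phiPoly (k : ℕ) :
    polyL2 (phiPoly k) = √((k : ℝ) + 1 / 2) • polyL2 (legendre k) := by
  rw [phiPoly, ← smul_eq_C_mul, map_smul]

lemma legendreCoeff_eq_inner (v : L2I) (k : ℕ) :
    legendreCoeff v k = ⟪polyL2 (phiPoly k), v⟫ := by
  rw [inner_polyL2, legendreCoeff]
  simp_rw [eval_phiPoly]

lemma orthonormal_phi : Orthonormal ℝ fun k => polyL2 (phiPoly k) := by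
  rw [orthonormal_iff_ite]
  intro i j
  rw [polyL2_phiPoly, polyL2_phiPoly, real_inner_smul_left, real_inner_smul_right,
    inner_polyL2_polyL2]
  split_ifs with h
  · subst h
    rw [← mul_assoc, Real.mul_self_sqrt (by positivity), integral_legendre_sq]
  · rw [integral_legendre_mul_legendre_of_ne (Ne.symm h)]; simp

lemma normL2_le_of_bound {f : ℝ → ℝ} {B : ℝ} (h : ∀ x ∈ Set.Ioo (-1 : ℝ) 1, |f x| ≤ B) :
    normL2 f ≤ ENNReal.ofReal (2 * B) := by
  refine (eLpNorm_le_of_ae_bound (C := B) (ae_volI_mem.mono fun x hx => h x hx)).trans ?_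
  rw [ENNReal.ofReal_mul zero_le_two]
  gcongr
  have h2 : volI Set.univ = 2 := by
    rw [volI, Measure.restrict_apply_univ, Real.volume_Ioo]; norm_num
  rw [h2]
  -- The sharp factor is `√2`; it is rounded up to `2`.
  calc (2 : ℝ≥0∞) ^ (ENNReal.toReal 2)⁻¹ ≤ 2 ^ (1 : ℝ) :=
        ENNReal.rpow_le_rpow_of_exponent_le (by norm_num) (by norm_num)
    _ = ENNReal.ofReal 2 := by simp

lemma normL2_sub_eval (v : L2I) (q : ℝ[X]) :
    normL2 (fun x => v x - q.eval x) = ENNReal.ofReal ‖v - polyL2 q‖ := by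
  rw [ofReal_norm, Lp.enorm_def, normL2]
  refine eLpNorm_congr_ae ?_
  filter_upwards [Lp.coeFn_sub v (polyL2 q), coeFn_polyL2 q] with x h1 h2
  rw [h1, Pi.sub_apply, h2]

lemma denseRange_polyL2 : DenseRange polyL2 := by
  refine Metric.denseRange_iff.2 fun v ε hε => ?_
  obtain ⟨g, -, hg, hgc, -⟩ := (Lp.memLp v).exists_hasCompactSupport_eLpNorm_sub_le
    ENNReal.ofNat_ne_top (ENNReal.ofReal_pos.2 (show 0 < ε / 4 by positivity)).ne'
  obtain ⟨q, hq⟩ := exists_polynomial_near_of_continuousOn (-1) 1 g hgc.continuousOn (ε / 8)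
    (by positivity)
  refine ⟨q, ?_⟩
  have h2 : normL2 (g - fun x => q.eval x) ≤ ENNReal.ofReal (ε / 4) := by
    refine (normL2_le_of_bound (B := ε / 8) fun x hx => ?_).trans (by gcongr; linarith)
    rw [Pi.sub_apply, abs_sub_comm]
    exact (hq x (Set.Ioo_subset_Icc_self hx)).le
  have h3 : normL2 (fun x => v x - q.eval x) ≤ ENNReal.ofReal (ε / 2) := by
    have h : (fun x => v x - q.eval x) = (v - g) + (g - fun x => q.eval x) := by
      ext x; simp
    rw [h, show ε / 2 = ε / 4 + ε / 4 by ring, ENNReal.ofReal_add (by positivity) (by positivity)]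
    exact (eLpNorm_add_le ((Lp.aestronglyMeasurable v).sub hgc.aestronglyMeasurable)
      (hgc.sub q.continuous).aestronglyMeasurable (by norm_num)).trans (add_le_add hg h2)
  rw [normL2_sub_eval, ENNReal.ofReal_le_ofReal_iff (by positivity)] at h3
  rw [dist_eq_norm]
  linarith

lemma span_phi_dense :
    ⊤ ≤ (Submodule.span ℝ (Set.range fun k => polyL2 (phiPoly k))).topologicalClosure := by
  have hle : LinearMap.range polyL2 ≤
      Submodule.span ℝ (Set.range fun k => polyL2 (phiPoly k)) := by
    rw [LinearMap.range_eq_map, ← span_range_legendre, Submodule.map_span, Submodule.span_le]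
    rintro _ ⟨_, ⟨k, rfl⟩, rfl⟩
    have h := Submodule.smul_mem _ (√((k : ℝ) + 1 / 2))⁻¹
      (Submodule.subset_span (R := ℝ) (Set.mem_range_self (f := fun k => polyL2 (phiPoly k)) k))
    have hk : √((k : ℝ) + 1 / 2) ≠ 0 := by positivity
    simp only [polyL2_phiPoly] at h ⊢
    rwa [smul_smul, inv_mul_cancel₀ hk, one_smul] at h
  have hd : (LinearMap.range polyL2).topologicalClosure = ⊤ :=
    Submodule.dense_iff_topologicalClosure_eq_top.1 denseRange_polyL2
  rw [← hd]
  exact Submodule.topologicalClosure_mono hle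

lemma hasSum_legendreCoeff (v : L2I) :
    HasSum (fun k => legendreCoeff v k • polyL2 (phiPoly k)) v := by
  have := (HilbertBasis.mk orthonormal_phi span_phi_dense).hasSum_repr v
  simpa [HilbertBasis.repr_apply_apply, legendreCoeff_eq_inner] using this

/-! ### Elementary estimates for `exp (-η k ^ t)` -/

/-- Exponential decay beats powers, with Gevrey control of the constant. -/
lemma pow_mul_exp_neg_rpow_le {t η : ℝ} (ht : 0 < t) (hη : 0 < η) (m : ℕ) {s : ℝ} (hs : 0 ≤ s) :
    s ^ m * Real.exp (-η * s ^ t) ≤ (((t * η)⁻¹) ^ (1 / t)) ^ m * (m ! : ℝ) ^ (1 / t) := by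
  -- The argument is chosen so that raising `x ^ m / m! ≤ exp x` to the power `1 / t` gives exactly
  -- `s ^ m` and `exp (η s ^ t)`.
  have h := Real.pow_div_factorial_le_exp (x := t * η * s ^ t) (by positivity) m
  have hm : (0 : ℝ) < m ! := by positivity
  rw [div_le_iff₀ hm] at h
  have h2 := Real.rpow_le_rpow (by positivity) h (show 0 ≤ 1 / t by positivity)
  rw [Real.mul_rpow (by positivity) (by positivity), ← Real.exp_mul, mul_pow,
    Real.mul_rpow (by positivity) (by positivity)] at h2
  have e1 : ((s ^ t) ^ m) ^ (1 / t) = s ^ m := by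
    rw [← Real.rpow_natCast, ← Real.rpow_mul hs, ← Real.rpow_mul hs,
      show t * m * (1 / t) = m by field_simp, Real.rpow_natCast]
  have e2 : ((t * η) ^ m) ^ (1 / t) = (((t * η)⁻¹ ^ (1 / t)) ^ m)⁻¹ := by
    rw [Real.inv_rpow (by positivity), inv_pow, inv_inv, ← Real.rpow_natCast,
      ← Real.rpow_natCast, ← Real.rpow_mul (by positivity), ← Real.rpow_mul (by positivity),
      mul_comm (m : ℝ)]
  have e3 : t * η * s ^ t * (1 / t) = η * s ^ t := by field_simp
  rw [e1, e2, e3] at h2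
  have hc : 0 < ((t * η)⁻¹ ^ (1 / t)) ^ m := by positivity
  rw [neg_mul, Real.exp_neg, ← div_eq_mul_inv, div_le_iff₀ (Real.exp_pos _), mul_assoc]
  rw [inv_mul_le_iff₀ hc] at h2
  linarith

/-- Subadditivity of `s ^ t`, the one place where `t ≤ 1` enters. It makes index shifts cost only a
constant factor. -/
lemma add_one_rpow_le {t : ℝ} (ht0 : 0 < t) (ht1 : t ≤ 1) (k : ℕ) :
    ((k : ℝ) + 1) ^ t ≤ (k : ℝ) ^ t + 1 := by
  simpa using Real.rpow_add_le_add_rpow (Nat.cast_nonneg k) zero_le_one ht0.le ht1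

lemma summable_pow_mul_exp {t η : ℝ} (ht0 : 0 < t) (hη : 0 < η) (m : ℕ) :
    Summable fun k : ℕ => ((k : ℝ) + 1) ^ m * Real.exp (-η * ((k : ℝ) + 1) ^ t) := by
  set A := (((t * η)⁻¹) ^ (1 / t)) ^ (m + 2) * ((m + 2)! : ℝ) ^ (1 / t)
  have hs : Summable fun k : ℕ => A * (((k : ℝ) + 1) ^ 2)⁻¹ := by
    refine Summable.mul_left _ ?_
    simpa using (summable_nat_add_iff 1).2 (Real.summable_nat_pow_inv.2 one_lt_two)
  refine hs.of_nonneg_of_le (fun k => by positivity) fun k => ?_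
  have h := pow_mul_exp_neg_rpow_le ht0 hη (m + 2) (s := (k : ℝ) + 1) (by positivity)
  rw [← div_eq_mul_inv, le_div_iff₀ (by positivity)]
  refine le_trans (le_of_eq ?_) h
  ring

/-- A decay bound in terms of `k` gives one in terms of `k + 1`. -/
lemma exp_neg_rpow_le {t η : ℝ} (ht0 : 0 < t) (ht1 : t ≤ 1) (hη : 0 < η) (k : ℕ) :
    Real.exp (-η * (k : ℝ) ^ t) ≤ Real.exp η * Real.exp (-η * ((k : ℝ) + 1) ^ t) := by
  rw [← Real.exp_add]
  refine Real.exp_le_exp.2 ?_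
  nlinarith [add_one_rpow_le ht0 ht1 k]

/-- Exponential decay of a sequence, in the sense of condition (iii). -/
def RapidDecay (t : ℝ) (c : ℕ → ℝ) : Prop :=
  ∃ M η : ℝ, 0 ≤ M ∧ 0 < η ∧ ∀ k : ℕ, |c k| ≤ M * Real.exp (-η * ((k : ℝ) + 1) ^ t)

lemma RapidDecay.summable_pow_mul {t : ℝ} (ht0 : 0 < t) {c : ℕ → ℝ} (hc : RapidDecay t c) (m : ℕ) :
    Summable fun k : ℕ => ((k : ℝ) + 1) ^ m * |c k| := by
  obtain ⟨M, η, hM, hη, h⟩ := hc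
  refine ((summable_pow_mul_exp ht0 hη m).mul_left M).of_nonneg_of_le
    (fun k => by positivity) fun k => ?_
  calc _ ≤ ((k : ℝ) + 1) ^ m * (M * Real.exp (-η * ((k : ℝ) + 1) ^ t)) := by gcongr; exact h k
    _ = _ := by ring

/-- The moments of a rapidly decaying sequence have Gevrey growth. -/
lemma RapidDecay.exists_tsum_le {t : ℝ} (ht0 : 0 < t) {c : ℕ → ℝ} (hc : RapidDecay t c) (r : ℕ) :
    ∃ B : ℝ, 0 ≤ B ∧ ∀ m : ℕ, ∑' k : ℕ, ((k : ℝ) + 1) ^ (m + r) * |c k| ≤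
      B ^ (m + 1) * (m ! : ℝ) ^ (1 / t) := by
  obtain ⟨M, η, hM, hη, h⟩ := id hc
  -- The exponential is split in half: one half absorbs the `m`-th power with its factorial, the
  -- other keeps the sum convergent uniformly in `m`.
  have hS := summable_pow_mul_exp ht0 (half_pos hη) r
  set S := ∑' k : ℕ, ((k : ℝ) + 1) ^ r * Real.exp (-(η / 2) * ((k : ℝ) + 1) ^ t)
  have hS0 : 0 ≤ S := tsum_nonneg fun k => by positivity
  set Q : ℝ := ((t * (η / 2))⁻¹) ^ (1 / t)
  have hQ : 0 ≤ Q := by positivity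
  refine ⟨max (M * S) Q, by positivity, fun m => ?_⟩
  calc ∑' k : ℕ, ((k : ℝ) + 1) ^ (m + r) * |c k|
      ≤ ∑' k : ℕ, (Q ^ m * (m ! : ℝ) ^ (1 / t) * M) *
          (((k : ℝ) + 1) ^ r * Real.exp (-(η / 2) * ((k : ℝ) + 1) ^ t)) := by
        refine (hc.summable_pow_mul ht0 (m + r)).tsum_le_tsum (fun k => ?_) (hS.mul_left _)
        have hk := pow_mul_exp_neg_rpow_le ht0 (half_pos hη) m (s := (k : ℝ) + 1) (by positivity)
        have he : Real.exp (-η * ((k : ℝ) + 1) ^ t) = Real.exp (-(η / 2) * ((k : ℝ) + 1) ^ t) *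
            Real.exp (-(η / 2) * ((k : ℝ) + 1) ^ t) := by
          rw [← Real.exp_add]; ring_nf
        calc ((k : ℝ) + 1) ^ (m + r) * |c k|
            ≤ ((k : ℝ) + 1) ^ (m + r) * (M * Real.exp (-η * ((k : ℝ) + 1) ^ t)) := by
              gcongr; exact h k
          _ = (((k : ℝ) + 1) ^ m * Real.exp (-(η / 2) * ((k : ℝ) + 1) ^ t)) * M *
              (((k : ℝ) + 1) ^ r * Real.exp (-(η / 2) * ((k : ℝ) + 1) ^ t)) := by
              rw [he]; ring
          _ ≤ _ := by gcongr
    _ = Q ^ m * (M * S) * (m ! : ℝ) ^ (1 / t) := by rw [tsum_mul_left]; ring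
    _ ≤ (max (M * S) Q) ^ (m + 1) * (m ! : ℝ) ^ (1 / t) := by
        rw [pow_succ]
        gcongr
        · exact le_max_right _ _
        · exact le_max_left _ _

/-! ### Decay of the coefficients and polynomial approximation -/

lemma abs_legendreCoeff_le_of_degree {v : L2I} {n k : ℕ} (hnk : n < k) {p : ℝ[X]}
    (hp : p ∈ degreeLE ℝ (n : WithBot ℕ)) : |legendreCoeff v k| ≤ ‖v - polyL2 p‖ := by
  have h0 : ⟪polyL2 (phiPoly k), polyL2 p⟫ = 0 := by
    rw [polyL2_phiPoly, real_inner_smul_left, inner_polyL2_polyL2,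
      integral_mul_legendre_of_degree_lt ((mem_degreeLE.1 hp).trans_lt (by exact_mod_cast hnk)),
      mul_zero]
  rw [legendreCoeff_eq_inner, ← sub_zero ⟪polyL2 (phiPoly k), v⟫, ← h0, ← inner_sub_right]
  refine (abs_real_inner_le_norm _ _).trans ?_
  have : ‖polyL2 (phiPoly k)‖ = 1 := orthonormal_phi.1 k
  rw [this, one_mul]

lemma abs_legendreCoeff_le_norm (v : L2I) (k : ℕ) : |legendreCoeff v k| ≤ ‖v‖ := by
  rw [legendreCoeff_eq_inner]
  refine (abs_real_inner_le_norm _ _).trans ?_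
  have : ‖polyL2 (phiPoly k)‖ = 1 := orthonormal_phi.1 k
  rw [this, one_mul]

lemma abs_legendreCoeff_succ_le_d2 (v : L2I) (n : ℕ) :
    ENNReal.ofReal |legendreCoeff v (n + 1)| ≤ d2 v n := by
  refine le_iInf fun p => ?_
  rw [normL2_sub_eval]
  exact ENNReal.ofReal_le_ofReal (abs_legendreCoeff_le_of_degree n.lt_succ_self p.2)

/-- The truncated Legendre series is the competitor; the triangle inequality suffices for its tail.
-/
lemma d2_le_tsum {v : L2I} (h : Summable fun k => |legendreCoeff v k|) (n : ℕ) :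
    d2 v n ≤ ENNReal.ofReal (∑' k, |legendreCoeff v (k + (n + 1))|) := by
  set p : ℝ[X] := ∑ k ∈ Finset.range (n + 1), legendreCoeff v k • phiPoly k with hp
  have hmem : p ∈ degreeLE ℝ (n : WithBot ℕ) := by
    refine Submodule.sum_mem _ fun k hk => Submodule.smul_mem _ _ (mem_degreeLE.2 ?_)
    rw [phiPoly, degree_C_mul (by positivity), degree_legendre]
    have := Finset.mem_range.1 hk
    exact_mod_cast Nat.lt_succ_iff.1 this
  refine (iInf_le _ ⟨p, hmem⟩).trans ?_
  rw [normL2_sub_eval]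
  refine ENNReal.ofReal_le_ofReal ?_
  have hn : ∀ k, ‖legendreCoeff v k • polyL2 (phiPoly k)‖ = |legendreCoeff v k| := fun k => by
    have : ‖polyL2 (phiPoly k)‖ = 1 := orthonormal_phi.1 k
    rw [norm_smul, this, mul_one, Real.norm_eq_abs]
  have hpe : polyL2 p = ∑ k ∈ Finset.range (n + 1), legendreCoeff v k • polyL2 (phiPoly k) := by
    rw [hp, map_sum]; simp_rw [map_smul]
  have hs : HasSum (fun k => legendreCoeff v (k + (n + 1)) • polyL2 (phiPoly (k + (n + 1))))
      (v - ∑ k ∈ Finset.range (n + 1), legendreCoeff v k • polyL2 (phiPoly k)) :=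
    (hasSum_nat_add_iff' (f := fun k => legendreCoeff v k • polyL2 (phiPoly k)) (n + 1)).2
      (hasSum_legendreCoeff v)
  have hs' : Summable fun k => |legendreCoeff v (k + (n + 1))| :=
    (summable_nat_add_iff (f := fun k => |legendreCoeff v k|) (n + 1)).2 h
  simp only [hpe]
  exact hs.norm_le_of_bounded hs'.hasSum fun k => (hn _).le

lemma rapidDecay_of_le {t : ℝ} (ht0 : 0 < t) (ht1 : t ≤ 1) {c : ℕ → ℝ} {M η : ℝ} (hM : 0 ≤ M)
    (hη : 0 < η) (h : ∀ k : ℕ, |c k| ≤ M * Real.exp (-η * (k : ℝ) ^ t)) : RapidDecay t c :=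
  ⟨M * Real.exp η, η, by positivity, hη, fun k => (h k).trans <| by
    rw [mul_assoc]; gcongr; exact exp_neg_rpow_le ht0 ht1 hη k⟩

/-- Coefficient `k + 1` is tested against degree `k`, and the shift costs `exp η`; coefficient `0`
sees no approximation space and is bounded by `‖v‖`. -/
lemma coeff_bound_of_d2_bound {t : ℝ} (ht0 : 0 < t) (ht1 : t ≤ 1) {v : L2I} {L η : ℝ}
    (hL : 0 ≤ L) (hη : 0 < η)
    (h : ∀ n : ℕ, d2 v n ≤ ENNReal.ofReal (L * Real.exp (-η * (n : ℝ) ^ t))) (k : ℕ) :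
    |legendreCoeff v k| ≤ max ‖v‖ (L * Real.exp η) * Real.exp (-η * (k : ℝ) ^ t) := by
  rcases k with _ | k
  · simpa [Real.zero_rpow ht0.ne'] using Or.inl (abs_legendreCoeff_le_norm v 0)
  · have h1 := (abs_legendreCoeff_succ_le_d2 v k).trans (h k)
    rw [ENNReal.ofReal_le_ofReal_iff (by positivity)] at h1
    refine h1.trans ?_
    calc _ ≤ L * (Real.exp η * Real.exp (-η * ((k : ℝ) + 1) ^ t)) := by
          gcongr; exact exp_neg_rpow_le ht0 ht1 hη k
      _ ≤ _ := by
          rw [← mul_assoc, Nat.cast_succ]; gcongr; exact le_max_right _ _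

lemma d2_bound_of_coeff_bound {t : ℝ} (ht0 : 0 < t) (ht1 : t ≤ 1) {v : L2I} {L η : ℝ}
    (hL : 0 ≤ L) (hη : 0 < η)
    (h : ∀ k : ℕ, |legendreCoeff v k| ≤ L * Real.exp (-η * (k : ℝ) ^ t)) :
    ∃ L₁ η₁ : ℝ, 0 ≤ L₁ ∧ 0 < η₁ ∧
      ∀ n : ℕ, d2 v n ≤ ENNReal.ofReal (L₁ * Real.exp (-η₁ * (n : ℝ) ^ t)) := by
  have hR := rapidDecay_of_le ht0 ht1 hL hη h
  have hsum : Summable fun k => |legendreCoeff v k| := by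
    simpa using hR.summable_pow_mul ht0 0
  have hS : Summable fun k : ℕ => Real.exp (-(η / 2) * ((k : ℝ) + 1) ^ t) := by
    simpa using summable_pow_mul_exp ht0 (half_pos hη) 0
  refine ⟨L * ∑' k : ℕ, Real.exp (-(η / 2) * ((k : ℝ) + 1) ^ t), η / 2,
    mul_nonneg hL (tsum_nonneg fun k => by positivity), half_pos hη, fun n => ?_⟩
  refine (d2_le_tsum hsum n).trans (ENNReal.ofReal_le_ofReal ?_)
  rw [mul_assoc, mul_comm (tsum _), ← mul_assoc, ← tsum_mul_left]
  refine ((summable_nat_add_iff (n + 1)).2 hsum).tsum_le_tsum (fun k => ?_) (hS.mul_left _)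
  refine (h _).trans ?_
  rw [mul_assoc, ← Real.exp_add]
  gcongr
  -- The index dominates both `n` and `k + 1`, so half of the exponent gives the decay in `n` and
  -- the other half a summable series in `k`.
  have h1 : (n : ℝ) ^ t ≤ ((k + (n + 1) : ℕ) : ℝ) ^ t := by
    gcongr; linarith [Nat.cast_nonneg (α := ℝ) k]
  have h2 : ((k : ℝ) + 1) ^ t ≤ ((k + (n + 1) : ℕ) : ℝ) ^ t := by
    gcongr; push_cast; linarith [Nat.cast_nonneg (α := ℝ) n]
  nlinarith

/-! ### Gevrey regularity implies decay of the coefficients -/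

lemma polyLegendreOp_phiPoly (k : ℕ) :
    polyLegendreOp (phiPoly k) = C ((k : ℝ) * (k + 1)) * phiPoly k := by
  have h := polyLegendreOp_legendre k
  simp only [polyLegendreOp, phiPoly, derivative_C_mul, mul_left_comm (1 - X ^ 2 : ℝ[X])] at h ⊢
  rw [← mul_neg, h]
  ring

lemma integral_iterate_legendreOp_mul_phi {u : ℝ → ℝ} {U : Set ℝ} (hU : IsOpen U)
    (hIU : Set.Icc (-1) 1 ⊆ U) (hu : ContDiffOn ℝ ∞ u U) (p k : ℕ) :
    ∫ x in (-1)..1, legendreOp^[p] u x * phi k x =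
      ((k : ℝ) * (k + 1)) ^ p * ∫ x in (-1)..1, u x * phi k x := by
  simp only [← eval_phiPoly]
  induction p with
  | zero => simp
  | succ p ih =>
    rw [Function.iterate_succ_apply', integral_legendreOp_mul hU hIU
      (contDiffOn_iterate_legendreOp hU hu p), polyLegendreOp_phiPoly, pow_succ', mul_assoc, ← ih,
      ← intervalIntegral.integral_const_mul]
    simp only [eval_mul, eval_C]
    congr 1; ext x; ring

lemma pow_mul_abs_legendreCoeff_le {u : ℝ → ℝ} {U : Set ℝ} (hU : IsOpen U)
    (hIU : Set.Icc (-1) 1 ⊆ U) (hu : ContDiffOn ℝ ∞ u U) {v : L2I}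
    (hv : (v : ℝ → ℝ) =ᵐ[volI] u) {p : ℕ} {B : ℝ} (hB : 0 ≤ B)
    (h : normL2 (legendreOp^[p] u) ≤ ENNReal.ofReal B) (k : ℕ) :
    (k : ℝ) ^ (2 * p) * |legendreCoeff v k| ≤ B := by
  have hc : ContinuousOn (legendreOp^[p] u) (Set.Ioo (-1) 1) :=
    (contDiffOn_iterate_legendreOp hU hu p).continuousOn.mono
      (Set.Ioo_subset_Icc_self.trans hIU)
  have hm : MemLp (legendreOp^[p] u) 2 volI :=
    ⟨hc.aestronglyMeasurable measurableSet_Ioo, h.trans_lt ENNReal.ofReal_lt_top⟩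
  have h1 : legendreCoeff hm.toLp k = ((k : ℝ) * (k + 1)) ^ p * legendreCoeff v k := by
    have e1 : legendreCoeff hm.toLp k = ∫ x in (-1)..1, legendreOp^[p] u x * phi k x := by
      rw [legendreCoeff, ← integral_volI]
      refine integral_congr_ae ?_
      filter_upwards [hm.coeFn_toLp] with x hx
      rw [hx]
    have e2 : legendreCoeff v k = ∫ x in (-1)..1, u x * phi k x := by
      rw [legendreCoeff, ← integral_volI]
      refine integral_congr_ae ?_
      filter_upwards [hv] with x hx
      rw [hx]
    rw [e1, e2, integral_iterate_legendreOp_mul_phi hU hIU hu]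
  have h2 := abs_legendreCoeff_le_norm hm.toLp k
  rw [Lp.norm_toLp, h1, abs_mul, abs_of_nonneg (by positivity)] at h2
  refine le_trans ?_ (h2.trans (ENNReal.toReal_le_of_le_ofReal hB h))
  rw [pow_mul]
  gcongr
  nlinarith [Nat.cast_nonneg (α := ℝ) k]

lemma coeff_bound_of_memBGGevrey {t : ℝ} (ht0 : 0 < t) {v : L2I} (hv : MemBGGevrey t v) :
    ∃ M η : ℝ, 0 ≤ M ∧ 0 < η ∧
      ∀ k : ℕ, |legendreCoeff v k| ≤ M * Real.exp (-η * (k : ℝ) ^ t) := by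
  obtain ⟨u, ⟨⟨U, hU, hIU, hu⟩, L, hL, hR⟩, hvu⟩ := hv
  have hp : ∀ p k : ℕ, (k : ℝ) ^ (2 * p) * |legendreCoeff v k| ≤
      (L + 1) ^ (2 * p + 1) * ((2 * p)! : ℝ) ^ (1 / t) := by
    intro p k
    refine pow_mul_abs_legendreCoeff_le hU hIU hu hvu (by positivity) ?_ k
    have h := hR (2 * p)
    rw [R, if_pos (even_two_mul p), Nat.mul_div_cancel_left p two_pos] at h
    refine h.trans (ENNReal.ofReal_le_ofReal ?_)
    gcongr
    linarith
  -- `L` may be zero, whereas `K` is inverted below.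
  set K := L + 1
  have hK : 0 < K := by positivity
  have hE : 0 < Real.exp 1 * K := by positivity
  -- With `a = (k / (e K)) ^ t` and `2p` the even integer in `(a - 2, a]`, one has `((2p)!) ^ (1/t)
  -- ≤ (k / (e K)) ^ (2p)`. After dividing by `k ^ (2p)` there remains `K e ^ (-2p) ≤ K e ^ 2 e ^
  -- (-a)`.
  refine ⟨K * Real.exp 2, ((Real.exp 1 * K)⁻¹) ^ t, by positivity, by positivity, fun k => ?_⟩
  set a : ℝ := ((Real.exp 1 * K)⁻¹ * k) ^ t with ha
  have ha0 : 0 ≤ a := by positivity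
  have hak : ((Real.exp 1 * K)⁻¹) ^ t * (k : ℝ) ^ t = a :=
    (Real.mul_rpow (by positivity) (by positivity)).symm
  have hat : a ^ (1 / t) = (Real.exp 1 * K)⁻¹ * k := by
    rw [ha, ← Real.rpow_mul (by positivity), mul_one_div_cancel ht0.ne', Real.rpow_one]
  set p := ⌊a / 2⌋₊ with hpdef
  have h1 : ((2 * p : ℕ) : ℝ) ≤ a := by
    have := Nat.floor_le (show 0 ≤ a / 2 by positivity)
    push_cast; linarith
  have h2 : a - 2 ≤ ((2 * p : ℕ) : ℝ) := by
    have := Nat.lt_floor_add_one (a / 2)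
    push_cast; linarith
  -- For `k = 0` also `p = 0`, and `0 ^ 0 = 1`.
  have hk : 0 < (k : ℝ) ^ (2 * p) := by
    rcases Nat.eq_zero_or_pos k with h0 | h0
    · have : p = 0 := by rw [hpdef, ha, h0]; simp [Real.zero_rpow ht0.ne']
      simp [this]
    · positivity
  have hfac : ((2 * p)! : ℝ) ^ (1 / t) ≤ ((Real.exp 1 * K)⁻¹ * k) ^ (2 * p) := by
    rw [← hat, ← Real.rpow_natCast, ← Real.rpow_mul ha0, mul_comm (1 / t), Real.rpow_mul ha0,
      Real.rpow_natCast]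
    gcongr
    calc ((2 * p)! : ℝ) ≤ ((2 * p : ℕ) : ℝ) ^ (2 * p) := by
          exact_mod_cast Nat.factorial_le_pow _
      _ ≤ a ^ (2 * p) := by gcongr
  have h3 : (k : ℝ) ^ (2 * p) * |legendreCoeff v k| ≤
      (k : ℝ) ^ (2 * p) * (K * Real.exp (-((2 * p : ℕ) : ℝ))) := by
    refine (hp p k).trans ((mul_le_mul_of_nonneg_left hfac (by positivity)).trans (le_of_eq ?_))
    rw [Real.exp_neg, ← Real.exp_one_pow, mul_pow, inv_pow, mul_pow, pow_succ K]
    field_simp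
  refine (le_of_mul_le_mul_left h3 hk).trans ?_
  rw [neg_mul, hak, mul_assoc, ← Real.exp_add]
  gcongr
  linarith

/-! ### Smooth extension of Legendre series beyond the interval -/

lemma contDiff_smoothTransition_comp (N s : ℝ) :
    ContDiff ℝ ∞ fun x => Real.smoothTransition (N + s * x) :=
  Real.smoothTransition.contDiff.comp (by fun_prop)

/-- Compactness on `[0, 1]`; the function is constant on each side of it. -/
lemma exists_bound_iteratedDeriv_smoothTransition (i : ℕ) :
    ∃ C : ℝ, 0 ≤ C ∧ ∀ y, |iteratedDeriv i Real.smoothTransition y| ≤ C := by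
  have hcont : Continuous (iteratedDeriv i Real.smoothTransition) :=
    (Real.smoothTransition.contDiff (n := ⊤)).continuous_iteratedDeriv i (by exact_mod_cast le_top)
  obtain ⟨C, hC⟩ := isCompact_Icc.exists_bound_of_continuousOn
    (hcont.continuousOn (s := Set.Icc (0 : ℝ) 1))
  refine ⟨max C 1, by positivity, fun y => ?_⟩
  by_cases hy : y ∈ Set.Icc (0 : ℝ) 1
  · exact (hC y hy).trans (le_max_left _ _)
  refine le_trans ?_ (le_max_right _ _)
  rcases lt_or_ge y 0 with h | h
  · have := Set.EqOn.iteratedDeriv_of_isOpen (f := Real.smoothTransition) (g := fun _ => (0 : ℝ))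
      (s := Set.Iio 0) (fun z hz => Real.smoothTransition.zero_of_nonpos (le_of_lt hz)) isOpen_Iio
      i h
    rw [this, iteratedDeriv_const]; simp
  · have h1 : 1 < y := by by_contra! h1; exact hy ⟨h, h1⟩
    have := Set.EqOn.iteratedDeriv_of_isOpen (f := Real.smoothTransition) (g := fun _ => (1 : ℝ))
      (s := Set.Ioi 1) (fun z hz => Real.smoothTransition.one_of_one_le (le_of_lt hz)) isOpen_Ioi
      i h1
    rw [this, iteratedDeriv_const]; split_ifs <;> simp

/-- All derivatives of the functions `f k` are bounded on `S k` by a power of `k + 1`. -/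
def PolynomiallyBounded (S : ℕ → Set ℝ) (f : ℕ → ℝ → ℝ) : Prop :=
  (∀ k, ContDiff ℝ ∞ (f k)) ∧ ∀ j : ℕ, ∃ (C : ℝ) (m : ℕ), 0 ≤ C ∧
    ∀ k, ∀ x ∈ S k, |iteratedDeriv j (f k) x| ≤ C * ((k : ℝ) + 1) ^ m

lemma PolynomiallyBounded.mul {S : ℕ → Set ℝ} {f g : ℕ → ℝ → ℝ} (hf : PolynomiallyBounded S f)
    (hg : PolynomiallyBounded S g) : PolynomiallyBounded S fun k x => f k x * g k x := by
  refine ⟨fun k => (hf.1 k).mul (hg.1 k), fun j => ?_⟩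
  choose C m hC hb using hf.2
  choose C' m' hC' hb' using hg.2
  refine ⟨∑ i ∈ Finset.range (j + 1), (j.choose i : ℝ) * C i * C' (j - i),
    ∑ i ∈ Finset.range (j + 1), (m i + m' (j - i)),
    Finset.sum_nonneg fun i _ => mul_nonneg (mul_nonneg (by positivity) (hC i)) (hC' _),
    fun k x hx => ?_⟩
  have hj : (j : WithTop ℕ∞) ≤ ((⊤ : ℕ∞) : WithTop ℕ∞) := by exact_mod_cast le_top
  rw [iteratedDeriv_fun_mul ((hf.1 k).contDiffAt.of_le hj) ((hg.1 k).contDiffAt.of_le hj),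
    Finset.sum_mul]
  refine (Finset.abs_sum_le_sum_abs _ _).trans (Finset.sum_le_sum fun i hi => ?_)
  rw [abs_mul, abs_mul, Nat.abs_cast]
  have h1 := hb i k x hx
  have h2 := hb' (j - i) k x hx
  calc _ ≤ (j.choose i : ℝ) * (C i * ((k : ℝ) + 1) ^ m i) *
        (C' (j - i) * ((k : ℝ) + 1) ^ m' (j - i)) := by
        have := (abs_nonneg _).trans h1
        gcongr
    _ = (j.choose i : ℝ) * C i * C' (j - i) * ((k : ℝ) + 1) ^ (m i + m' (j - i)) := by
        rw [pow_add]; ring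
    _ ≤ _ := by
        have := hC i
        have := hC' (j - i)
        gcongr
        · linarith [Nat.cast_nonneg (α := ℝ) k]
        · exact Finset.single_le_sum (f := fun i => m i + m' (j - i)) (fun _ _ => Nat.zero_le _) hi

/-- A smooth step equal to `1` where `s x ≤ 1` and to `0` where `s x ≥ 1 + 1 / (k + 1) ^ 2`. -/
def smoothStep (s : ℝ) (k : ℕ) (x : ℝ) : ℝ :=
  Real.smoothTransition (1 + ((k : ℝ) + 1) ^ 2 + -(((k : ℝ) + 1) ^ 2 * s) * x)

lemma polynomiallyBounded_smoothStep (S : ℕ → Set ℝ) {s : ℝ} (hs : |s| = 1) :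
    PolynomiallyBounded S (smoothStep s) := by
  refine ⟨fun k => contDiff_smoothTransition_comp _ _, fun j => ?_⟩
  obtain ⟨C, hC, hb⟩ := exists_bound_iteratedDeriv_smoothTransition j
  refine ⟨C, 2 * j, hC, fun k x _ => ?_⟩
  have h : iteratedDeriv j (smoothStep s k) x = (-(((k : ℝ) + 1) ^ 2 * s)) ^ j *
      iteratedDeriv j Real.smoothTransition
        (1 + ((k : ℝ) + 1) ^ 2 + -(((k : ℝ) + 1) ^ 2 * s) * x) := by
    have h0 : ContDiff ℝ j fun y => Real.smoothTransition (1 + ((k : ℝ) + 1) ^ 2 + y) := by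
      have := (contDiff_smoothTransition_comp (1 + ((k : ℝ) + 1) ^ 2) 1).of_le
        (show (j : WithTop ℕ∞) ≤ ((⊤ : ℕ∞) : WithTop ℕ∞) by exact_mod_cast le_top)
      simpa using this
    have h1 := iteratedDeriv_comp_const_mul h0 (-(((k : ℝ) + 1) ^ 2 * s))
    rw [iteratedDeriv_comp_const_add] at h1
    exact congrFun h1 x
  rw [h, abs_mul, abs_pow, abs_neg, abs_mul, hs, mul_one, abs_of_nonneg (by positivity), ← pow_mul,
    mul_comm]
  gcongr
  exact hb _

lemma smoothStep_eq_one {s : ℝ} {k : ℕ} {x : ℝ} (h : s * x ≤ 1) : smoothStep s k x = 1 := by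
  refine Real.smoothTransition.one_of_one_le ?_
  nlinarith [mul_nonneg (sq_nonneg ((k : ℝ) + 1)) (sub_nonneg.2 h)]

lemma smoothStep_eq_zero {s : ℝ} {k : ℕ} {x : ℝ} (h : 1 + 1 / ((k : ℝ) + 1) ^ 2 ≤ s * x) :
    smoothStep s k x = 0 := by
  refine Real.smoothTransition.zero_of_nonpos ?_
  have hk : (0 : ℝ) < ((k : ℝ) + 1) ^ 2 := by positivity
  have := mul_le_mul_of_nonneg_left h hk.le
  rw [mul_add, mul_one_div_cancel hk.ne'] at this
  linarith

lemma iteratedDeriv_eval (q : ℝ[X]) (j : ℕ) :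
    iteratedDeriv j (fun x => q.eval x) = fun x => (derivative^[j] q).eval x := by
  induction j with
  | zero => simp
  | succ j ih =>
    rw [iteratedDeriv_succ, ih, Function.iterate_succ_apply']
    ext x
    rw [Polynomial.deriv]

lemma sqrt_add_half_le (k : ℕ) : √((k : ℝ) + 1 / 2) ≤ (k : ℝ) + 1 :=
  Real.sqrt_le_iff.2 ⟨by positivity, by nlinarith [Nat.cast_nonneg (α := ℝ) k]⟩

lemma abs_iterate_derivative_phiPoly_le {x A : ℝ} {k : ℕ}
    (h : ∀ l ≤ k, |(legendre l).eval x| ≤ A) (j : ℕ) :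
    |(derivative^[j] (phiPoly k)).eval x| ≤ A * ((k : ℝ) + 1) ^ (2 * j + 1) := by
  have hA : 0 ≤ A := (abs_nonneg _).trans (h 0 (Nat.zero_le k))
  rw [phiPoly, iterate_derivative_C_mul, eval_mul, eval_C, abs_mul, abs_of_nonneg (by positivity)]
  calc _ ≤ ((k : ℝ) + 1) * (A * (k : ℝ) ^ (2 * j)) := by
        gcongr
        · exact sqrt_add_half_le k
        · exact abs_iterate_derivative_legendre_le h j k le_rfl
    _ ≤ ((k : ℝ) + 1) * (A * ((k : ℝ) + 1) ^ (2 * j)) := by gcongr; linarith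
    _ = _ := by ring

lemma abs_iterate_derivative_phiPoly_le_of_mem {x : ℝ} (hx : x ∈ Set.Icc (-1 : ℝ) 1) (k j : ℕ) :
    |(derivative^[j] (phiPoly k)).eval x| ≤ ((k : ℝ) + 1) ^ (2 * j + 1) := by
  simpa using abs_iterate_derivative_phiPoly_le (A := 1)
    (fun l (_ : l ≤ k) => abs_legendre_eval_le_one l hx) j

/-- The neighbourhood of `[-1, 1]` on which `φ_k` is still under control. -/
def enlarged (k : ℕ) : Set ℝ := {x | |x| ≤ 1 + 1 / ((k : ℝ) + 1) ^ 2}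

/-- The width `(k + 1) ^ (-2)` gives `l ^ 2 (|x| - 1) ≤ 1` for every `l ≤ k`, so all these `L_l` are
at most `e` there and the bound passes to derivatives of `φ_k`. -/
lemma polynomiallyBounded_phi :
    PolynomiallyBounded enlarged fun k x => (phiPoly k).eval x := by
  refine ⟨fun k => contDiff_eval _, fun j => ⟨Real.exp 1, 2 * j + 1, by positivity,
    fun k x hx => ?_⟩⟩
  rw [iteratedDeriv_eval]
  refine abs_iterate_derivative_phiPoly_le (fun l hl => abs_legendre_eval_le_exp l ?_) j
  have hx' : |x| - 1 ≤ 1 / ((k : ℝ) + 1) ^ 2 := by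
    have : |x| ≤ 1 + 1 / ((k : ℝ) + 1) ^ 2 := hx
    linarith
  calc (l : ℝ) ^ 2 * (|x| - 1) ≤ (l : ℝ) ^ 2 * (1 / ((k : ℝ) + 1) ^ 2) := by gcongr
    _ ≤ ((k : ℝ) + 1) ^ 2 * (1 / ((k : ℝ) + 1) ^ 2) := by
        gcongr
        exact_mod_cast hl.trans (Nat.le_succ k)
    _ = 1 := mul_one_div_cancel (by positivity)

/-- The function `φ_k`, cut off smoothly outside `[-1, 1]`. -/
def cutoffPhi (k : ℕ) (x : ℝ) : ℝ := smoothStep 1 k x * smoothStep (-1) k x * (phiPoly k).eval x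

lemma cutoffPhi_eq {x : ℝ} (hx : x ∈ Set.Icc (-1 : ℝ) 1) (k : ℕ) :
    cutoffPhi k x = (phiPoly k).eval x := by
  rw [cutoffPhi, smoothStep_eq_one (by linarith [hx.2]), smoothStep_eq_one (by linarith [hx.1]),
    one_mul, one_mul]

lemma cutoffPhi_eq_zero {x : ℝ} {k : ℕ} (hx : x ∉ enlarged k) : cutoffPhi k x = 0 := by
  have h : 1 + 1 / ((k : ℝ) + 1) ^ 2 < |x| := not_le.1 hx
  rcases lt_abs.1 h with h | h
  · rw [cutoffPhi, smoothStep_eq_zero (by linarith), zero_mul, zero_mul]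
  · rw [cutoffPhi, smoothStep_eq_zero (s := -1) (by linarith), mul_zero, zero_mul]

/-- Leibniz on the enlarged interval; on its open complement the function vanishes identically, so
all derivatives do. -/
lemma polynomiallyBounded_cutoffPhi : PolynomiallyBounded (fun _ => Set.univ) cutoffPhi := by
  have h := ((polynomiallyBounded_smoothStep enlarged (s := 1) (by simp)).mul
    (polynomiallyBounded_smoothStep enlarged (s := -1) (by simp))).mul polynomiallyBounded_phi
  refine ⟨h.1, fun j => ?_⟩
  obtain ⟨C, m, hC, hb⟩ := h.2 j
  refine ⟨C, m, hC, fun k x _ => ?_⟩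
  by_cases hx : x ∈ enlarged k
  · exact hb k x hx
  · have hopen : IsOpen (enlarged k)ᶜ :=
      (isClosed_le continuous_abs continuous_const).isOpen_compl
    rw [Set.EqOn.iteratedDeriv_of_isOpen (g := fun _ => (0 : ℝ))
      (fun z hz => cutoffPhi_eq_zero hz) hopen j hx, iteratedDeriv_const]
    simp only [ite_self, abs_zero]
    positivity

/-- A smooth extension to the real line of the Legendre series with coefficients `c`. -/
def legendreSeries (c : ℕ → ℝ) (x : ℝ) : ℝ := ∑' k, c k * cutoffPhi k x

/-- All moments of the sequence `c` are finite. -/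
def RapidlyDecreasing (c : ℕ → ℝ) : Prop := ∀ m : ℕ, Summable fun k : ℕ => ((k : ℝ) + 1) ^ m * |c k|

lemma contDiff_legendreSeries {c : ℕ → ℝ} (hc : RapidlyDecreasing c) :
    ContDiff ℝ ∞ (legendreSeries c) := by
  choose C m hC hb using polynomiallyBounded_cutoffPhi.2
  refine contDiff_tsum (v := fun (j k : ℕ) => C j * (((k : ℝ) + 1) ^ m j * |c k|))
    (fun k => contDiff_const.mul (polynomiallyBounded_cutoffPhi.1 k))
    (fun j _ => (hc (m j)).mul_left _) fun j k x _ => ?_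
  rw [norm_iteratedFDeriv_eq_norm_iteratedDeriv, iteratedDeriv_const_mul_field, Real.norm_eq_abs,
    abs_mul]
  calc _ ≤ |c k| * (C j * ((k : ℝ) + 1) ^ m j) := by gcongr; exact hb j k x (Set.mem_univ x)
    _ = _ := by ring

lemma legendreSeries_eq (c : ℕ → ℝ) {x : ℝ} (hx : x ∈ Set.Icc (-1 : ℝ) 1) :
    legendreSeries c x = ∑' k, c k * (phiPoly k).eval x := by
  simp_rw [legendreSeries, cutoffPhi_eq hx]

/-! ### The Legendre operator acting on Legendre series -/

lemma RapidlyDecreasing.summable_mul_eval {c : ℕ → ℝ} (hc : RapidlyDecreasing c)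
    {q : ℕ → ℝ[X]} {m : ℕ} {x : ℝ}
    (hq : ∀ k : ℕ, |(q k).eval x| ≤ ((k : ℝ) + 1) ^ m) :
    Summable fun k => c k * (q k).eval x := by
  refine (hc m).of_norm_bounded fun k => ?_
  rw [Real.norm_eq_abs, abs_mul, mul_comm]
  gcongr
  exact hq k

lemma RapidlyDecreasing.abs_tsum_mul_eval_le {c : ℕ → ℝ} (hc : RapidlyDecreasing c)
    {q : ℕ → ℝ[X]} {m : ℕ} {x : ℝ}
    (hq : ∀ k : ℕ, |(q k).eval x| ≤ ((k : ℝ) + 1) ^ m) :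
    |∑' k, c k * (q k).eval x| ≤ ∑' k : ℕ, ((k : ℝ) + 1) ^ m * |c k| := by
  rw [← Real.norm_eq_abs]
  refine tsum_of_norm_bounded (hc m).hasSum fun k => ?_
  rw [Real.norm_eq_abs, abs_mul, mul_comm]
  gcongr
  exact hq k

lemma RapidlyDecreasing.hasDerivAt_tsum {c : ℕ → ℝ} (hc : RapidlyDecreasing c)
    {q : ℕ → ℝ[X]} {m m' : ℕ}
    (hq : ∀ k : ℕ, ∀ x ∈ Set.Icc (-1 : ℝ) 1, |(q k).eval x| ≤ ((k : ℝ) + 1) ^ m)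
    (hq' : ∀ k : ℕ, ∀ x ∈ Set.Icc (-1 : ℝ) 1,
      |(derivative (q k)).eval x| ≤ ((k : ℝ) + 1) ^ m')
    {f : ℝ → ℝ} (hf : ∀ x ∈ Set.Ioo (-1 : ℝ) 1, f x = ∑' k, c k * (q k).eval x)
    {x : ℝ} (hx : x ∈ Set.Ioo (-1 : ℝ) 1) :
    HasDerivAt f (∑' k, c k * (derivative (q k)).eval x) x := by
  have h := hasDerivAt_tsum_of_isPreconnected (hc m') isOpen_Ioo isPreconnected_Ioo
    (g := fun k y => c k * (q k).eval y) (g' := fun k y => c k * (derivative (q k)).eval y)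
    (fun k y _ => ((q k).hasDerivAt y).const_mul (c k))
    (fun k y hy => by
      rw [Real.norm_eq_abs, abs_mul, mul_comm]
      gcongr
      exact hq' k y (Set.Ioo_subset_Icc_self hy)) hx
    (hc.summable_mul_eval fun k => hq k x (Set.Ioo_subset_Icc_self hx)) hx
  refine h.congr_of_eventuallyEq ?_
  filter_upwards [isOpen_Ioo.mem_nhds hx] with y hy using hf y hy

lemma abs_phiPoly_le {x : ℝ} (hx : x ∈ Set.Icc (-1 : ℝ) 1) (k : ℕ) :
    |(phiPoly k).eval x| ≤ ((k : ℝ) + 1) ^ 1 :=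
  abs_iterate_derivative_phiPoly_le_of_mem hx k 0

lemma abs_derivative_phiPoly_le {x : ℝ} (hx : x ∈ Set.Icc (-1 : ℝ) 1) (k : ℕ) :
    |(derivative (phiPoly k)).eval x| ≤ ((k : ℝ) + 1) ^ 3 :=
  abs_iterate_derivative_phiPoly_le_of_mem hx k 1

lemma abs_one_sub_sq_mul_derivative_phiPoly_le {x : ℝ} (hx : x ∈ Set.Icc (-1 : ℝ) 1) (k : ℕ) :
    |((1 - X ^ 2) * derivative (phiPoly k)).eval x| ≤ ((k : ℝ) + 1) ^ 3 := by
  have h1 : 0 ≤ 1 - x ^ 2 := by nlinarith [hx.1, hx.2]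
  have h2 : 1 - x ^ 2 ≤ 1 := by nlinarith
  rw [eval_mul, abs_mul, eval_sub, eval_one, eval_pow, eval_X, abs_of_nonneg h1]
  exact (mul_le_of_le_one_left (abs_nonneg _) h2).trans (abs_derivative_phiPoly_le hx k)

lemma abs_derivative_one_sub_sq_mul_derivative_phiPoly_le {x : ℝ} (hx : x ∈ Set.Icc (-1 : ℝ) 1)
    (k : ℕ) : |(derivative ((1 - X ^ 2) * derivative (phiPoly k))).eval x| ≤ ((k : ℝ) + 1) ^ 3 := by
  have h : derivative ((1 - X ^ 2) * derivative (phiPoly k)) =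
      -(C ((k : ℝ) * (k + 1)) * phiPoly k) := by
    rw [← polyLegendreOp_phiPoly, polyLegendreOp, neg_neg]
  rw [h, eval_neg, abs_neg, eval_mul, eval_C, abs_mul, abs_of_nonneg (by positivity)]
  calc _ ≤ ((k : ℝ) + 1) ^ 2 * ((k : ℝ) + 1) ^ 1 := by
        gcongr
        · nlinarith [Nat.cast_nonneg (α := ℝ) k]
        · exact abs_phiPoly_le hx k
    _ = _ := by ring

lemma RapidlyDecreasing.one_sub_sq_mul_deriv_eq {c : ℕ → ℝ} (hc : RapidlyDecreasing c) {f : ℝ → ℝ}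
    (hf : ∀ x ∈ Set.Ioo (-1 : ℝ) 1, f x = ∑' k, c k * (phiPoly k).eval x)
    {x : ℝ} (hx : x ∈ Set.Ioo (-1 : ℝ) 1) :
    (1 - x ^ 2) * deriv f x = ∑' k, c k * ((1 - X ^ 2) * derivative (phiPoly k)).eval x := by
  rw [(hc.hasDerivAt_tsum (fun k y hy => abs_phiPoly_le hy k)
    (fun k y hy => abs_derivative_phiPoly_le hy k) hf hx).deriv, ← tsum_mul_left]
  refine tsum_congr fun k => ?_
  simp only [eval_mul, eval_sub, eval_one, eval_pow, eval_X]
  ring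

/-- Two termwise differentiations. The result is again a Legendre series with rapidly decreasing
coefficients, which lets the operator be iterated. -/
lemma RapidlyDecreasing.legendreOp_eq {c : ℕ → ℝ} (hc : RapidlyDecreasing c) {f : ℝ → ℝ}
    (hf : ∀ x ∈ Set.Ioo (-1 : ℝ) 1, f x = ∑' k, c k * (phiPoly k).eval x)
    {x : ℝ} (hx : x ∈ Set.Ioo (-1 : ℝ) 1) :
    legendreOp f x = ∑' k : ℕ, (k * (k + 1) * c k) * (phiPoly k).eval x := by
  rw [legendreOp, (hc.hasDerivAt_tsum
    (fun k y hy => abs_one_sub_sq_mul_derivative_phiPoly_le hy k)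
    (fun k y hy => abs_derivative_one_sub_sq_mul_derivative_phiPoly_le hy k)
    (fun y hy => hc.one_sub_sq_mul_deriv_eq hf hy) hx).deriv, ← tsum_neg]
  refine tsum_congr fun k => ?_
  rw [← mul_neg, ← eval_neg]
  have h := polyLegendreOp_phiPoly k
  rw [polyLegendreOp] at h
  rw [h, eval_mul, eval_C]
  ring

lemma pow_mul_abs_eigenvalue_mul_le (c : ℕ → ℝ) (p m k : ℕ) :
    ((k : ℝ) + 1) ^ m * |((k : ℝ) * (k + 1)) ^ p * c k| ≤ ((k : ℝ) + 1) ^ (2 * p + m) * |c k| := by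
  have h : ((k : ℝ) * (k + 1)) ^ p ≤ ((k : ℝ) + 1) ^ (2 * p) := by
    rw [pow_mul]
    gcongr
    nlinarith [Nat.cast_nonneg (α := ℝ) k]
  rw [abs_mul, abs_of_nonneg (by positivity), pow_add, ← mul_assoc, mul_comm (((k : ℝ) + 1) ^ m)]
  gcongr

lemma RapidlyDecreasing.eigenvalue_mul {c : ℕ → ℝ} (hc : RapidlyDecreasing c) (p : ℕ) :
    RapidlyDecreasing fun k : ℕ => ((k : ℝ) * (k + 1)) ^ p * c k := fun m =>
  (hc (2 * p + m)).of_nonneg_of_le (fun _ => by positivity)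
    (pow_mul_abs_eigenvalue_mul_le c p m)

lemma RapidlyDecreasing.tsum_eigenvalue_mul_le {c : ℕ → ℝ} (hc : RapidlyDecreasing c) (p m : ℕ) :
    ∑' k : ℕ, ((k : ℝ) + 1) ^ m * |((k : ℝ) * (k + 1)) ^ p * c k| ≤
      ∑' k : ℕ, ((k : ℝ) + 1) ^ (2 * p + m) * |c k| :=
  (hc.eigenvalue_mul p m).tsum_le_tsum (pow_mul_abs_eigenvalue_mul_le c p m) (hc (2 * p + m))

lemma RapidlyDecreasing.iterate_legendreOp_eq {c : ℕ → ℝ} (hc : RapidlyDecreasing c) {f : ℝ → ℝ}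
    (hf : ∀ x ∈ Set.Ioo (-1 : ℝ) 1, f x = ∑' k, c k * (phiPoly k).eval x) (p : ℕ) :
    ∀ x ∈ Set.Ioo (-1 : ℝ) 1, legendreOp^[p] f x =
      ∑' k : ℕ, (((k : ℝ) * (k + 1)) ^ p * c k) * (phiPoly k).eval x := by
  induction p with
  | zero => simpa using hf
  | succ p ih =>
    intro x hx
    rw [Function.iterate_succ_apply', (hc.eigenvalue_mul p).legendreOp_eq ih hx]
    refine tsum_congr fun k => ?_
    ring

/-- For `n = 2p + 1` the exponent is `2p + 3`, the `3` coming from `φ_k'`; for `n = 2p`, `2p + 1`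
would do and is raised to give one formula. -/
lemma RapidlyDecreasing.abs_R_le {c : ℕ → ℝ} (hc : RapidlyDecreasing c) {f : ℝ → ℝ}
    (hf : ∀ x ∈ Set.Ioo (-1 : ℝ) 1, f x = ∑' k, c k * (phiPoly k).eval x) (n : ℕ)
    {x : ℝ} (hx : x ∈ Set.Ioo (-1 : ℝ) 1) :
    |R n f x| ≤ ∑' k : ℕ, ((k : ℝ) + 1) ^ (n + 2) * |c k| := by
  have hx' := Set.Ioo_subset_Icc_self hx
  have hp := hc.iterate_legendreOp_eq hf (n / 2)
  have hcp := hc.eigenvalue_mul (n / 2)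
  unfold R
  split_ifs with hn
  · have h2 : 2 * (n / 2) = n := Nat.two_mul_div_two_of_even hn
    have h := hc.tsum_eigenvalue_mul_le (n / 2) 2
    rw [h2] at h
    refine le_trans ?_ h
    rw [hp x hx]
    refine hcp.abs_tsum_mul_eval_le fun k => (abs_phiPoly_le hx' k).trans ?_
    exact pow_le_pow_right₀ (by linarith [Nat.cast_nonneg (α := ℝ) k]) one_le_two
  · have h2 : 2 * (n / 2) + 3 = n + 2 := by
      have := Nat.two_mul_div_two_add_one_of_odd (Nat.not_even_iff_odd.1 hn)
      omega
    have h := hc.tsum_eigenvalue_mul_le (n / 2) 3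
    rw [h2] at h
    refine le_trans ?_ h
    beta_reduce
    rw [hcp.one_sub_sq_mul_deriv_eq hp hx]
    exact hcp.abs_tsum_mul_eval_le fun k => abs_one_sub_sq_mul_derivative_phiPoly_le hx' k

/-! ### Decay of the coefficients implies Gevrey regularity -/

/-- An element of `L²(I)` with rapidly decreasing Legendre coefficients is almost everywhere the
sum of its Legendre series. -/
lemma ae_eq_of_rapidlyDecreasing {v : L2I} (hc : RapidlyDecreasing (legendreCoeff v)) {u : ℝ → ℝ}
    (hu : Continuous u)
    (h : ∀ x ∈ Set.Ioo (-1 : ℝ) 1, u x = ∑' k, legendreCoeff v k * (phiPoly k).eval x) :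
    (v : ℝ → ℝ) =ᵐ[volI] u := by
  have hm : MemLp u 2 volI := by
    refine MemLp.of_bound hu.aestronglyMeasurable
      (∑' k : ℕ, ((k : ℝ) + 1) ^ 1 * |legendreCoeff v k|) (ae_volI_mem.mono fun x hx => ?_)
    rw [h x hx]
    exact hc.abs_tsum_mul_eval_le fun k => abs_phiPoly_le (Set.Ioo_subset_Icc_self hx) k
  let w : L2I := hm.toLp u
  have hw : w =ᵐ[volI] u := hm.coeFn_toLp
  set b : ℕ → ℝ := fun k => ((k : ℝ) + 1) ^ 1 * |legendreCoeff v k| with hb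
  set S : ℕ → ℝ[X] := fun n => ∑ k ∈ Finset.range n, legendreCoeff v k • phiPoly k with hS
  -- Uniform tail bounds make the partial sums converge in `L²(I)` to `w`; they also converge to
  -- `v`, so the limits agree.
  have hbound : ∀ n, ‖w - polyL2 (S n)‖ ≤ 2 * ∑' k, b (k + n) := by
    intro n
    have h0 : 0 ≤ ∑' k, b (k + n) := tsum_nonneg fun k => by positivity
    have h1 : normL2 (fun x => w x - (S n).eval x) ≤
        ENNReal.ofReal (2 * ∑' k, b (k + n)) := by
      have e : normL2 (fun x => w x - (S n).eval x) =
          normL2 fun x => u x - (S n).eval x :=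
        eLpNorm_congr_ae (by filter_upwards [hw] with x hx; rw [hx])
      rw [e]
      refine normL2_le_of_bound fun x hx => ?_
      have hx' := Set.Ioo_subset_Icc_self hx
      have hsum : Summable fun k => legendreCoeff v k * (phiPoly k).eval x :=
        hc.summable_mul_eval fun k => abs_phiPoly_le hx' k
      have e2 : u x - (S n).eval x =
          ∑' k, legendreCoeff v (k + n) * (phiPoly (k + n)).eval x := by
        rw [h x hx, ← hsum.sum_add_tsum_nat_add n, hS]
        simp [eval_finsetSum]
      rw [e2]
      have hbn : Summable fun k => b (k + n) := (summable_nat_add_iff n).2 (hc 1)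
      rw [← Real.norm_eq_abs]
      refine tsum_of_norm_bounded hbn.hasSum fun k => ?_
      rw [Real.norm_eq_abs, abs_mul, mul_comm]
      simp only [hb]
      gcongr
      exact abs_phiPoly_le hx' (k + n)
    rwa [normL2_sub_eval, ENNReal.ofReal_le_ofReal_iff (by positivity)] at h1
  have hlim1 : Filter.Tendsto (fun n => polyL2 (S n)) Filter.atTop (nhds w) := by
    rw [tendsto_iff_norm_sub_tendsto_zero]
    refine squeeze_zero (fun _ => norm_nonneg _)
      (fun n => (norm_sub_rev _ _).trans_le (hbound n)) ?_
    simpa using (tendsto_sum_nat_add b).const_mul 2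
  have hlim2 : Filter.Tendsto (fun n => polyL2 (S n)) Filter.atTop (nhds v) := by
    refine (hasSum_legendreCoeff v).tendsto_sum_nat.congr fun n => ?_
    rw [hS, map_sum]
    simp_rw [map_smul]
  rw [tendsto_nhds_unique hlim2 hlim1]
  exact hw

lemma memBGGevrey_of_rapidDecay {t : ℝ} (ht0 : 0 < t) {v : L2I}
    (hv : RapidDecay t (legendreCoeff v)) : MemBGGevrey t v := by
  have hc : RapidlyDecreasing (legendreCoeff v) := hv.summable_pow_mul ht0
  have hsmooth := contDiff_legendreSeries hc
  have heq : ∀ x ∈ Set.Ioo (-1 : ℝ) 1, legendreSeries (legendreCoeff v) x =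
      ∑' k, legendreCoeff v k * (phiPoly k).eval x := fun x hx =>
    legendreSeries_eq _ (Set.Ioo_subset_Icc_self hx)
  obtain ⟨B, hB, hbound⟩ := hv.exists_tsum_le ht0 2
  refine ⟨legendreSeries (legendreCoeff v), ⟨⟨Set.univ, isOpen_univ, Set.subset_univ _,
    hsmooth.contDiffOn⟩, 2 * B, by positivity, fun n => ?_⟩,
    ae_eq_of_rapidlyDecreasing hc hsmooth.continuous heq⟩
  refine (normL2_le_of_bound fun x hx => (hc.abs_R_le heq n hx).trans (hbound n)).trans
    (ENNReal.ofReal_le_ofReal ?_)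
  rw [← mul_assoc, mul_pow]
  gcongr
  -- The factor `2` from comparing the `L²` and sup norms is absorbed in `(2 B) ^ (n + 1)`.
  exact le_self_pow₀ one_le_two n.succ_ne_zero

end LegendreGevrey

end

/-! ### The equivalence, with (iii) as the hub -/

theorem mainTheorem7 (t : ℝ) (ht0 : 0 < t) (ht1 : t ≤ 1) (v : LegendreGevrey.L2I) :
    List.TFAE [
      LegendreGevrey.MemBGGevrey t v,
      ∃ L₁ η₁ : ℝ, 0 ≤ L₁ ∧ 0 < η₁ ∧
        ∀ n : ℕ, LegendreGevrey.d2 v n ≤ ENNReal.ofReal (L₁ * Real.exp (-η₁ * (n : ℝ) ^ t)),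
      ∃ L₂ η₂ : ℝ, 0 ≤ L₂ ∧ 0 < η₂ ∧
        ∀ k : ℕ, |LegendreGevrey.legendreCoeff v k| ≤ L₂ * Real.exp (-η₂ * (k : ℝ) ^ t)] := by
  tfae_have 1 → 3 := LegendreGevrey.coeff_bound_of_memBGGevrey ht0
  tfae_have 3 → 1 := fun ⟨_, _, hL, hη, h⟩ =>
    LegendreGevrey.memBGGevrey_of_rapidDecay ht0
      (LegendreGevrey.rapidDecay_of_le ht0 ht1 hL hη h)
  tfae_have 3 → 2 := fun ⟨_, _, hL, hη, h⟩ =>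
    LegendreGevrey.d2_bound_of_coeff_bound ht0 ht1 hL hη h
  tfae_have 2 → 3 := fun ⟨_, η, hL, hη, h⟩ =>
    ⟨_, η, by positivity, hη, LegendreGevrey.coeff_bound_of_d2_bound ht0 ht1 hL hη h⟩
  tfae_finish
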